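/- Let $k$ be a field of characteristic zero. Let $\mathrm{Ass}_n$ be the algebra of noncommutative formal power series over $k$ in $x_1,\dots,x_n$ (the degree completion of the free associative algebra), $\mathrm{Ass}_n^+$ its ideal of series without constant term, and $\mathfrak{lie}_n\subset \mathrm{Ass}_n^+$ the degree completion of the free Lie algebra on $x_1,\dots,x_n$; for $n=2$ write $x,y$ for the generators. Let $\mathrm{ch}(a,b)=\ln(e^ae^b)$ be the Campbell–Hausdorff series and $\mathrm{ad}_a(b)=ab-ba$. Let $\mathfrak{tr}_n=\mathrm{Ass}_n^+/\mathrm{span}\{ab-ba : a,b\in \mathrm{Ass}_n\}$, with natural projection $\mathrm{Tr}$. Let $\tilde\delta:\mathfrak{tr}_1\to\mathfrak{tr}_2$ be the linear map $$\tilde\delta(\mathrm{Tr} f(x))=\mathrm{Tr}\big(f(y)-f(\mathrm{ch}(x,y))+f(x)\big),\qquad f\in x\,k[[x]].$$ Let $\mathfrak{der}^{t}_n$ be the Lie algebra of tangential derivations of $\mathfrak{lie}_n$, that is, derivations $u$ with $u(x_i)=[x_i,a_i]$ for some $a_i\in\mathfrak{lie}_n$; write $u=(a_1,\dots,a_n)$,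 where each $a_i$ is normalised to have no linear term in $x_i$ (this determines the $a_i$). Such $u$ acts on $\mathrm{Ass}_n$ by continuous derivations, and hence on $\mathfrak{tr}_n$. Its divergence is $\mathrm{div}(u)=\sum_i\mathrm{Tr}(x_i\,\partial_i a_i)\in\mathfrak{tr}_n$, where the $\partial_i$ are defined by $a=a_0+\sum_i(\partial_i a)x_i$ with $a_0\in k$. Let $\mathrm{Der}^t_n=\exp(\mathfrak{der}^t_n)$ be the group integrating $\mathfrak{der}^t_n$, where $\exp(u)$ acts as the automorphism $\sum_{m\ge0}u^m/m!$, and let $j:\mathrm{Der}^t_n\to\mathfrak{tr}_n$ be the group cocycle integrating the divergence, $$j(\exp u)=\frac{e^u-1}{u}\cdot\mathrm{div}(u)=\sum_{m\ge 0}\frac{1}{(m+1)!}\,u^m\cdot\mathrm{div}(u).$$ Let $l$ be the derivation with $l(x_i)=x_i$ for all $i$, and for $g\in \mathrm{Der}^t_n$ put $\kappa(g)=l-g\,l\,g^{-1}$. An element $F\in \mathrm{Der}^t_2$ is a *solution of the generalized Kashiwara–Vergne problem* if $$F(x+y)=\mathrm{ch}(x,y)\quad\text{and}\quad j(F)\in\mathrm{im}(\tilde\delta).$$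 **Theorem.** Let $F\in\mathrm{Der}^t_2$. Then $\kappa(F)$ is a tangential derivation, given by a unique normalised pair $u=\kappa(F)=(A,B)\in\mathfrak{der}^t_2$, and $F$ is a solution of the generalized Kashiwara–Vergne problem if and only if $$x+y-\mathrm{ch}(y,x)=(1-e^{-\mathrm{ad}_x})A+(e^{\mathrm{ad}_y}-1)B$$ and $$\mathrm{div}(u)\in\mathrm{im}(\tilde\delta).$$ -/

import Mathlib

/-! Noncommutative power series, the completed free Lie algebra, tangential derivations,
the group of tangential automorphisms, and the Kashiwara-Vergne problem. -/

namespace KV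

/-- The degree completion of the free associative `k`-algebra on the generators `X i`, `i : Fin n`:
noncommutative formal power series.  A series is the family of its coefficients, indexed by
words in the letters `Fin n`. -/
def Ass (k : Type*) (n : ℕ) : Type _ := List (Fin n) → k

/-- The series with the given coefficients. -/
def Ass.of {k : Type*} {n : ℕ} (f : List (Fin n) → k) : Ass k n := f

@[simp] theorem Ass.of_apply {k : Type*} {n : ℕ} (f : List (Fin n) → k) (w : List (Fin n)) :
    Ass.of f w = f w := rfl

@[ext] theorem Ass.ext {k : Type*} {n : ℕ} {f g : Ass k n} (h : ∀ w, f w = g w) : f = g :=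
  funext h

noncomputable section

variable {k : Type*} [Field k] {n m : ℕ}

instance : AddCommGroup (Ass k n) := inferInstanceAs (AddCommGroup (List (Fin n) → k))

instance : Module k (Ass k n) := inferInstanceAs (Module k (List (Fin n) → k))

@[simp] theorem Ass.zero_apply (w : List (Fin n)) : (0 : Ass k n) w = 0 := rfl

@[simp] theorem Ass.add_apply (f g : Ass k n) (w : List (Fin n)) : (f + g) w = f w + g w := rfl

@[simp] theorem Ass.neg_apply (f : Ass k n) (w : List (Fin n)) : (-f) w = -f w := rfl

@[simp] theorem Ass.sub_apply (f g : Ass k n) (w : List (Fin n)) : (f - g) w = f w - g w := rfl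

@[simp] theorem Ass.smul_apply (c : k) (f : Ass k n) (w : List (Fin n)) :
    (c • f) w = c * f w := rfl

/-- Evaluation of the coefficient of the word `w`. -/
def coeff (w : List (Fin n)) : Ass k n →ₗ[k] k where
  toFun f := f w
  map_add' _ _ := rfl
  map_smul' _ _ := rfl

@[simp] theorem coeff_apply (w : List (Fin n)) (f : Ass k n) : coeff w f = f w := rfl

@[simp] theorem Ass.sum_apply {ι : Type*} (s : Finset ι) (f : ι → Ass k n) (w : List (Fin n)) :
    (∑ i ∈ s, f i) w = ∑ i ∈ s, f i w := map_sum (coeff w) f s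

/-- The concatenation product, `(f * g)(w) = ∑_{w = uv} f(u) g(v)`. -/
instance : Mul (Ass k n) :=
  ⟨fun f g => Ass.of fun w => ∑ i ∈ Finset.range (w.length + 1), f (w.take i) * g (w.drop i)⟩

theorem Ass.mul_apply (f g : Ass k n) (w : List (Fin n)) :
    (f * g) w = ∑ i ∈ Finset.range (w.length + 1), f (w.take i) * g (w.drop i) := rfl

instance : One (Ass k n) := ⟨Ass.of fun w => if w = [] then 1 else 0⟩

theorem Ass.one_apply (w : List (Fin n)) : (1 : Ass k n) w = if w = [] then 1 else 0 := rfl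

theorem Ass.mul_assoc' (f g h : Ass k n) : f * g * h = f * (g * h) := by
  ext w
  simp only [Ass.mul_apply, Finset.sum_mul, Finset.mul_sum]
  rw [Finset.sum_sigma', Finset.sum_sigma']
  refine Finset.sum_bij' (fun p _ => ⟨p.2, p.1 - p.2⟩) (fun p _ => ⟨p.1 + p.2, p.1⟩)
    ?_ ?_ ?_ ?_ ?_
  · rintro ⟨a, b⟩ h
    simp only [Finset.mem_sigma, Finset.mem_range, List.length_take, List.length_drop] at h ⊢
    omega
  · rintro ⟨a, b⟩ h
    simp only [Finset.mem_sigma, Finset.mem_range, List.length_take, List.length_drop] at h ⊢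
    omega
  · rintro ⟨a, b⟩ h
    simp only [Finset.mem_sigma, Finset.mem_range, List.length_take] at h
    have : b + (a - b) = a := by omega
    simp [this]
  · rintro ⟨a, b⟩ h
    simp
  · rintro ⟨a, b⟩ h
    simp only [Finset.mem_sigma, Finset.mem_range, List.length_take] at h
    have h1 : min b a = b := by omega
    have h2 : b + (a - b) = a := by omega
    simp only [List.take_take, List.drop_drop, List.drop_take, h1, h2, _root_.mul_assoc]

instance : Ring (Ass k n) where
  __ := (inferInstance : AddCommGroup (Ass k n))
  mul_assoc := Ass.mul_assoc'
  one_mul f := by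
    ext w
    rw [Ass.mul_apply, Finset.sum_eq_single 0]
    · simp [Ass.one_apply]
    · intro b hb hb0
      rw [Finset.mem_range] at hb
      have : w.take b ≠ [] := by
        intro h
        have := congrArg List.length h
        simp only [List.length_take, List.length_nil] at this
        omega
      simp [Ass.one_apply, this]
    · simp
  mul_one f := by
    ext w
    rw [Ass.mul_apply, Finset.sum_eq_single w.length]
    · simp [Ass.one_apply]
    · intro b hb hb0
      rw [Finset.mem_range] at hb
      have : w.drop b ≠ [] := by
        intro h
        have := congrArg List.length h
        simp only [List.length_drop, List.length_nil] at this
        omega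
      simp [Ass.one_apply, this]
    · simp
  zero_mul f := by ext w; simp [Ass.mul_apply]
  mul_zero f := by ext w; simp [Ass.mul_apply]
  left_distrib f g h := by ext w; simp [Ass.mul_apply, mul_add, Finset.sum_add_distrib]
  right_distrib f g h := by ext w; simp [Ass.mul_apply, add_mul, Finset.sum_add_distrib]

instance : Algebra k (Ass k n) :=
  Algebra.ofModule
    (fun c f g => by ext w; simp [Ass.mul_apply, Finset.mul_sum, mul_assoc])
    (fun c f g => by ext w; simp [Ass.mul_apply, Finset.mul_sum, mul_left_comm])

/-- The generator `x_i`. -/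
def X (i : Fin n) : Ass k n := Ass.of fun w => if w = [i] then 1 else 0

/-- The sum `∑_{d ≥ 0} c d` of a sequence of series in which all words of `c d` have length at
least `d`: on a word of length `N` only the terms with `d ≤ N` contribute.  It is used
below only for such sequences. -/
def seriesSum : (ℕ → Ass k n) →ₗ[k] Ass k n where
  toFun c := Ass.of fun w => ∑ d ∈ Finset.range (w.length + 1), c d w
  map_add' c e := by ext w; simp [Finset.sum_add_distrib]
  map_smul' r c := by ext w; simp [Finset.mul_sum]

/-- `e^a = ∑ a^d / d!`, for `a` without constant term. -/
def expA (a : Ass k n) : Ass k n := seriesSum fun d => (d.factorial : k)⁻¹ • a ^ d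

/-- `ln g = ∑_{d ≥ 0} (-1)^d (g - 1)^(d+1) / (d+1)`, for `g` with constant term `1`. -/
def logA (g : Ass k n) : Ass k n :=
  seriesSum fun d => ((-1 : k) ^ d / ((d : k) + 1)) • (g - 1) ^ (d + 1)

/-- The Campbell-Hausdorff series `ch(a, b) = ln (e^a e^b)`. -/
def ch (a b : Ass k n) : Ass k n := logA (expA a * expA b)

/-- `e^T = ∑ T^d / d!` for a linear operator `T` on series that raises the degree. -/
def expEnd (T : Module.End k (Ass k n)) : Module.End k (Ass k n) :=
  seriesSum ∘ₗ LinearMap.pi fun d => (d.factorial : k)⁻¹ • T ^ d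

/-- `(e^T - 1) / T = ∑ T^d / (d+1)!` for a linear operator `T` on series that raises the
degree. -/
def expSubOneDiv (T : Module.End k (Ass k n)) : Module.End k (Ass k n) :=
  seriesSum ∘ₗ LinearMap.pi fun d => ((d + 1).factorial : k)⁻¹ • T ^ d

/-- `ad_a b = ab - ba`. -/
def ad (a : Ass k n) : Module.End k (Ass k n) := LinearMap.mulLeft k a - LinearMap.mulRight k a

/-- Substitution `f(a_1, …, a_m)` of series `a_i` without constant term into a series `f`. -/
def subst (a : Fin m → Ass k n) : Ass k m →ₗ[k] Ass k n :=
  seriesSum ∘ₗ LinearMap.pi fun d =>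
    ∑ v : Fin d → Fin m,
      (coeff (List.ofFn v)).smulRight ((List.ofFn v).map a).prod

/-- The value on a word of the derivation that sends `x_i` to `b i`. -/
def wordDer (b : Fin n → Ass k n) : List (Fin n) → Ass k n
  | [] => 0
  | i :: w => b i * (w.map X).prod + X i * wordDer b w

/-- The (continuous) derivation of `Ass k n` with `x_i ↦ b i`, for `b i` without constant term. -/
def derivation (b : Fin n → Ass k n) : Module.End k (Ass k n) :=
  seriesSum ∘ₗ LinearMap.pi fun d =>
    ∑ v : Fin d → Fin n, (coeff (List.ofFn v)).smulRight (wordDer b (List.ofFn v))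

/-- The derivation `l` with `l(x_i) = x_i` for all `i`. -/
def euler : Module.End k (Ass k n) := derivation X

/-- The homogeneous component of degree `d`. -/
def homog (d : ℕ) : Ass k n →ₗ[k] Ass k n where
  toFun f := Ass.of fun w => if w.length = d then f w else 0
  map_add' f g := by ext w; by_cases h : w.length = d <;> simp [h]
  map_smul' c f := by ext w; by_cases h : w.length = d <;> simp [h]

section
attribute [local instance 100] LieRing.ofAssociativeRing

/-- Lie polynomials: the Lie subalgebra of the free associative algebra generated by the
`x_i`, which is the free Lie algebra on these generators. -/
def liePoly (k : Type*) [Field k] (n : ℕ) : LieSubalgebra k (Ass k n) :=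
  LieSubalgebra.lieSpan k (Ass k n) (Set.range X)

/-- `lie_n`, the degree completion of the free Lie algebra: series all of whose homogeneous
components are Lie polynomials. -/
def lie (k : Type*) [Field k] (n : ℕ) : Submodule k (Ass k n) :=
  ⨅ d : ℕ, (liePoly k n).toSubmodule.comap (homog d)

end

/-- Tangential derivations of `lie_n`, as tuples `u = (a_1, …, a_n)` of elements of `lie_n`,
normalised so that `a_i` has no linear term in `x_i`.  The derivation is `tangential u`. -/
def dert (k : Type*) [Field k] (n : ℕ) : Submodule k (Fin n → Ass k n) :=
  ⨅ i : Fin n, (lie k n ⊓ LinearMap.ker (coeff [i])).comap (LinearMap.proj i)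

/-- The derivation `x_i ↦ [x_i, a_i]` defined by `u = (a_1, …, a_n)`. -/
def tangential (u : dert k n) : Module.End k (Ass k n) :=
  derivation fun i => ad (X i) (u.1 i)

/-- The group integrating `dert_n`.  As a set it is a copy of `dert_n`, and `Dert.exp` and
`Dert.log` are the two identifications. -/
structure Dert (k : Type*) [Field k] (n : ℕ) where
  /-- the exponential map -/
  exp ::
  /-- the logarithm -/
  log : dert k n

/-- The inverse `exp(u)⁻¹ = exp(-u)`. -/
instance : Inv (Dert k n) := ⟨fun g => Dert.exp (-g.log)⟩

/-- The automorphism `exp(u) = ∑ u^d / d!` of the completed free algebra; it restricts to an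
automorphism of `lie_n`. -/
def Dert.act (g : Dert k n) : Module.End k (Ass k n) := expEnd (tangential g.log)

/-- `κ(g) = l - g l g⁻¹`, as an operator. -/
def kappa (g : Dert k n) : Module.End k (Ass k n) := euler - g.act * euler * g⁻¹.act

/-- Series without constant term. -/
def AssPlus (k : Type*) [Field k] (n : ℕ) : Submodule k (Ass k n) := LinearMap.ker (coeff [])

/-- The span of the commutators `ab - ba`, inside the series without constant term. -/
def commutators (k : Type*) [Field k] (n : ℕ) : Submodule k (AssPlus k n) :=
  (Submodule.span k {c : Ass k n | ∃ a b, c = a * b - b * a}).comap (AssPlus k n).subtype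

/-- `tr_n`. -/
abbrev tr (k : Type*) [Field k] (n : ℕ) : Type _ := AssPlus k n ⧸ commutators k n

/-- The projection that removes the constant term. -/
def dropConst : Ass k n →ₗ[k] AssPlus k n :=
  (LinearMap.id - (coeff []).smulRight (1 : Ass k n)).codRestrict (AssPlus k n)
    (fun f => by simp [AssPlus, Ass.one_apply])

/-- The natural projection `Tr`. -/
def Tr : Ass k n →ₗ[k] tr k n := (commutators k n).mkQ ∘ₗ dropConst

/-- `∂_i a`, where `a = a_0 + ∑ (∂_i a) x_i`. -/
def partialDer (i : Fin n) : Ass k n →ₗ[k] Ass k n where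
  toFun a := Ass.of fun w => a (w ++ [i])
  map_add' _ _ := rfl
  map_smul' _ _ := rfl

/-- The representative `∑ x_i (∂_i a_i)` of the divergence of `u = (a_1, …, a_n)`. -/
def divRep (u : dert k n) : Ass k n := ∑ i, X i * partialDer i (u.1 i)

/-- The divergence `div(u) = ∑ Tr(x_i (∂_i a_i))`. -/
def div (u : dert k n) : tr k n := Tr (divRep u)

/-- The group cocycle integrating the divergence,
`j(exp u) = ((e^u - 1)/u) · div(u) = ∑ u^d · div(u) / (d+1)!`.
The action of `u` on `tr_n` is induced by its action on series, so the sum may be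
computed on a representative. -/
def j (g : Dert k n) : tr k n := Tr (expSubOneDiv (tangential g.log) (divRep g.log))

theorem Ass.mul_comm_one (f g : Ass k 1) : f * g = g * f := by
  have key : ∀ v w : List (Fin 1), v.length = w.length → v = w := by
    intro v w h
    exact List.ext_getElem h fun i _ _ => Subsingleton.elim _ _
  ext w
  rw [Ass.mul_apply, Ass.mul_apply, ← Finset.sum_range_reflect]
  refine Finset.sum_congr rfl fun i hi => ?_
  rw [Finset.mem_range] at hi
  rw [mul_comm, key (w.drop (w.length + 1 - 1 - i)) (w.take i),
    key (w.take (w.length + 1 - 1 - i)) (w.drop i)]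
  · simp only [List.length_take, List.length_drop]; omega
  · simp only [List.length_take, List.length_drop]; omega

theorem commutators_one : commutators k 1 = ⊥ := by
  rw [commutators, show {c : Ass k 1 | ∃ a b, c = a * b - b * a} = {0} by
    ext c
    change (∃ a b, c = a * b - b * a) ↔ c = 0
    constructor
    · rintro ⟨a, b, rfl⟩
      rw [Ass.mul_comm_one, sub_self]
    · rintro rfl
      exact ⟨0, 0, by simp⟩]
  simp

/-- The differential on `tr_1`: `f(x) ↦ f(y) - f(ch(x, y)) + f(x)`. -/
def deltaTilde (k : Type*) [Field k] : tr k 1 →ₗ[k] tr k 2 :=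
  (commutators k 1).liftQ
    (Tr ∘ₗ (subst (fun _ => X 1) - subst (fun _ => ch (X 0) (X 1)) + subst (fun _ => X 0)) ∘ₗ
      (AssPlus k 1).subtype)
    (by rw [commutators_one]; exact bot_le)

/-- `F` solves the generalized Kashiwara-Vergne problem: `F(x + y) = ch(x, y)` and `j(F)` lies
in the image of the differential. -/
def IsGeneralizedKVSolution (F : Dert k 2) : Prop :=
  F.act (X 0 + X 1) = ch (X 0) (X 1) ∧ j F ∈ LinearMap.range (deltaTilde k)

/-- The original Kashiwara-Vergne equation for a pair `(A, B)`. -/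
def OriginalKVEquation (A B : Ass k 2) : Prop :=
  X 0 + X 1 - ch (X 1) (X 0) =
    (1 - expEnd (-ad (X 0))) A + (expEnd (ad (X 1)) - 1) B

end

end KV

/-!
Since `l` multiplies homogeneous series by their degree and `x + y` is the linear part of
`ch(x, y)`, the equation `F(x + y) = ch(x, y)` says that `F l F⁻¹` fixes `ch(x, y)`, that is, that
the derivation `u - l` multiplies `ln(e^x e^y)` by `-1`, where `u = κ(F)`. Equivalently
`(u - l)(e^x e^y) = -ch(x, y) e^x e^y`, and multiplying by `e^(-x)` on the left and by `e^(-y)` on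
the right turns this into the original Kashiwara-Vergne equation.

The cocycle identities give `div κ(F) = F l F⁻¹ · j(F)` in `tr_n`. If `F(x + y) = ch(x, y)`, then
`F l F⁻¹ = l - u` fixes `ch(x, y)` and sends `x` and `y` to themselves plus inner terms, so it maps
`δ̃(Tr f)` to `δ̃(Tr (l f))`. As it acts injectively on `tr_2`, and `l` maps onto `tr_1`, the
element `j(F)` lies in the image of `δ̃` if and only if `div κ(F)` does.
-/

namespace KV

noncomputable section

open Finset.HasAntidiagonal (antidiagonal)

variable {k : Type*} [Field k] {m n : ℕ}

/-- The series all of whose words have length at least `N`: these submodules are a basis of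
neighbourhoods of `0` in the degree completion. -/
def filtration (k : Type*) [Field k] (n N : ℕ) : Submodule k (Ass k n) where
  carrier := {f | ∀ w : List (Fin n), w.length < N → f w = 0}
  add_mem' hf hg w hw := by simp [hf w hw, hg w hw]
  zero_mem' w _ := rfl
  smul_mem' c f hf w hw := by simp [hf w hw]

theorem filtration_anti {N M : ℕ} (h : N ≤ M) : filtration k n M ≤ filtration k n N :=
  fun _ hf w hw => hf w (hw.trans_le h)

theorem mem_filtration_zero (f : Ass k n) : f ∈ filtration k n 0 :=
  fun _ hw => absurd hw (Nat.not_lt_zero _)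

theorem mem_filtration_one {f : Ass k n} : f ∈ filtration k n 1 ↔ f [] = 0 := by
  refine ⟨fun h => h [] Nat.one_pos, fun h w hw => ?_⟩
  rwa [List.length_eq_zero_iff.mp (Nat.lt_one_iff.mp hw)]

theorem mul_mem_filtration {N M : ℕ} {f g : Ass k n} (hf : f ∈ filtration k n N)
    (hg : g ∈ filtration k n M) : f * g ∈ filtration k n (N + M) := by
  intro w hw
  rw [Ass.mul_apply]
  refine Finset.sum_eq_zero fun i hi => ?_
  rw [Finset.mem_range] at hi
  by_cases h : i < N
  · rw [hf _ (by rw [List.length_take]; omega), zero_mul]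
  · rw [hg (w.drop i) (by rw [List.length_drop]; omega), mul_zero]

theorem pow_mem_filtration {a : Ass k n} (ha : a ∈ filtration k n 1) (d : ℕ) :
    a ^ d ∈ filtration k n d := by
  induction d with
  | zero => exact mem_filtration_zero _
  | succ d ih => rw [pow_succ]; exact mul_mem_filtration ih ha

theorem X_mem_filtration (i : Fin n) : (X i : Ass k n) ∈ filtration k n 1 :=
  mem_filtration_one.2 (by simp [X])

theorem prod_map_mem_filtration {a : Fin m → Ass k n} (ha : ∀ i, a i ∈ filtration k n 1)
    (w : List (Fin m)) : (w.map a).prod ∈ filtration k n w.length := by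
  induction w with
  | nil => exact mem_filtration_zero _
  | cons i w ih =>
    rw [List.map_cons, List.prod_cons, List.length_cons, add_comm]
    exact mul_mem_filtration (ha i) ih

/-- Linear maps that raise the degree by at least `r`; those with `r = 0` are continuous. -/
def RaisesDegree (r : ℕ) (T : Ass k m →ₗ[k] Ass k n) : Prop :=
  ∀ N, ∀ f ∈ filtration k m N, T f ∈ filtration k n (N + r)

namespace RaisesDegree

variable {p r s : ℕ} {T S : Ass k m →ₗ[k] Ass k n}

theorem mono (h : r ≤ s) (hT : RaisesDegree s T) : RaisesDegree r T :=
  fun N f hf => filtration_anti (Nat.add_le_add_left h N) (hT N f hf)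

theorem continuous (hT : RaisesDegree r T) : RaisesDegree 0 T := hT.mono (Nat.zero_le _)

theorem add (hT : RaisesDegree r T) (hS : RaisesDegree r S) : RaisesDegree r (T + S) :=
  fun N f hf => add_mem (hT N f hf) (hS N f hf)

theorem sub (hT : RaisesDegree r T) (hS : RaisesDegree r S) : RaisesDegree r (T - S) :=
  fun N f hf => sub_mem (hT N f hf) (hS N f hf)

theorem neg (hT : RaisesDegree r T) : RaisesDegree r (-T) :=
  fun N f hf => neg_mem (hT N f hf)

theorem comp {S : Ass k p →ₗ[k] Ass k m} (hT : RaisesDegree r T) (hS : RaisesDegree s S) :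
    RaisesDegree (s + r) (T ∘ₗ S) :=
  fun N f hf => by rw [← add_assoc]; exact hT _ _ (hS N f hf)

theorem one : RaisesDegree 0 (1 : Module.End k (Ass k n)) := fun _ _ hf => hf

theorem mul {T S : Module.End k (Ass k n)} (hT : RaisesDegree r T) (hS : RaisesDegree s S) :
    RaisesDegree (s + r) (T * S) := hT.comp hS

theorem pow {T : Module.End k (Ass k n)} (hT : RaisesDegree 1 T) (d : ℕ) :
    RaisesDegree d (T ^ d) := by
  induction d with
  | zero => exact one
  | succ d ih => rw [pow_succ, add_comm]; exact ih.mul hT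

theorem pow_apply_mem {T : Module.End k (Ass k n)} (hT : RaisesDegree 1 T) (d : ℕ) (f : Ass k n) :
    (T ^ d) f ∈ filtration k n d := by
  simpa using hT.pow d 0 f (mem_filtration_zero f)

theorem mulLeft {a : Ass k n} (ha : a ∈ filtration k n r) :
    RaisesDegree r (LinearMap.mulLeft k a) :=
  fun N f hf => by rw [add_comm]; exact mul_mem_filtration ha hf

theorem mulRight {a : Ass k n} (ha : a ∈ filtration k n r) :
    RaisesDegree r (LinearMap.mulRight k a) :=
  fun _ _ hf => mul_mem_filtration hf ha

theorem ad {a : Ass k n} (ha : a ∈ filtration k n r) : RaisesDegree r (ad a) :=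
  (mulLeft ha).sub (mulRight ha)

end RaisesDegree

theorem ad_apply (a f : Ass k n) : ad a f = a * f - f * a := rfl

/-! ### Convergent series -/

theorem seriesSum_apply (c : ℕ → Ass k n) (w : List (Fin n)) :
    seriesSum c w = ∑ d ∈ Finset.range (w.length + 1), c d w := rfl

theorem seriesSum_mem_filtration {N : ℕ} {c : ℕ → Ass k n} (hc : ∀ d, c d ∈ filtration k n N) :
    seriesSum c ∈ filtration k n N :=
  fun w hw => (seriesSum_apply c w).trans (Finset.sum_eq_zero fun d _ => hc d w hw)

theorem seriesSum_eq_single {c : ℕ → Ass k n} {N : ℕ} (hN : c N ∈ filtration k n N)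
    (hc : ∀ d ≠ N, c d = 0) : seriesSum c = c N := by
  ext w
  rw [seriesSum_apply]
  refine Finset.sum_eq_single N (fun d _ hd => by rw [hc d hd]; rfl) fun hd => hN w ?_
  simpa [Nat.lt_succ_iff] using hd

theorem seriesSum_sub_sum_range_mem {c : ℕ → Ass k n} (hc : ∀ d, c d ∈ filtration k n d) (N : ℕ) :
    seriesSum c - ∑ d ∈ Finset.range N, c d ∈ filtration k n N := fun w hw => by
  rw [Ass.sub_apply, seriesSum_apply, Ass.sum_apply, sub_eq_zero]
  refine Finset.sum_subset (Finset.range_mono hw) fun d _ hd => hc d w ?_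
  simpa [Nat.lt_succ_iff] using hd

theorem map_seriesSum {T : Ass k m →ₗ[k] Ass k n} (hT : RaisesDegree 0 T) {c : ℕ → Ass k m}
    (hc : ∀ d, c d ∈ filtration k m d) : T (seriesSum c) = seriesSum fun d => T (c d) := by
  ext w
  have h := hT _ _ (seriesSum_sub_sum_range_mem hc (w.length + 1)) w (Nat.lt_succ_self _)
  rwa [map_sub, map_sum, Ass.sub_apply, sub_eq_zero, Ass.sum_apply] at h

theorem seriesSum_succ {c : ℕ → Ass k n} (hc : ∀ d, c d ∈ filtration k n d) :
    seriesSum c = c 0 + seriesSum fun d => c (d + 1) := by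
  ext w
  rw [Ass.add_apply, seriesSum_apply, seriesSum_apply, Finset.sum_range_succ',
    Finset.sum_range_succ _ w.length, hc (w.length + 1) w (Nat.lt_succ_self _)]
  ring

theorem seriesSum_seriesSum {c : ℕ → ℕ → Ass k n} (hc : ∀ p q, c p q ∈ filtration k n (p + q)) :
    (seriesSum fun p => seriesSum (c p)) =
      seriesSum fun d => ∑ x ∈ antidiagonal d, c x.1 x.2 := by
  ext w
  simp only [seriesSum_apply, Ass.sum_apply, Finset.Nat.sum_antidiagonal_eq_sum_range_succ_mk]
  rw [← Finset.sum_product', Finset.sum_sigma']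
  symm
  refine Finset.sum_bij_ne_zero (fun x _ _ => (x.2, x.1 - x.2)) ?_ ?_ ?_ fun _ _ _ => rfl
  · rintro ⟨d, p⟩ h _
    simp only [Finset.mem_sigma, Finset.mem_product, Finset.mem_range] at h ⊢
    omega
  · rintro ⟨d, p⟩ h _ ⟨d', p'⟩ h' _ heq
    simp only [Finset.mem_sigma, Finset.mem_range, Prod.mk.injEq] at h h' heq
    obtain ⟨rfl, _⟩ := heq
    obtain rfl : d = d' := by omega
    rfl
  · rintro ⟨p, q⟩ _ hne
    have hpq : p + q < w.length + 1 := not_le.1 fun h => hne (hc p q w (by omega))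
    refine ⟨⟨p + q, p⟩, ?_, by simpa using hne, by simp⟩
    simp only [Finset.mem_sigma, Finset.mem_range]
    omega

/-! ### Words -/

theorem X_mul_nil (i : Fin n) (f : Ass k n) : (X i * f : Ass k n) [] = 0 := by
  simp [Ass.mul_apply, X]

theorem X_mul_cons (i j : Fin n) (f : Ass k n) (w : List (Fin n)) :
    (X i * f : Ass k n) (j :: w) = if j = i then f w else 0 := by
  rw [Ass.mul_apply, Finset.sum_eq_single 1]
  · simp [X]
  · intro b hb hb1
    rw [Finset.mem_range, List.length_cons] at hb
    have : (j :: w).take b ≠ [i] := fun h => by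
      have := congrArg List.length h
      simp only [List.length_take, List.length_cons, List.length_nil] at this
      omega
    simp [X, this]
  · simp

theorem mul_X_nil (i : Fin n) (f : Ass k n) : (f * X i : Ass k n) [] = 0 := by
  simp [Ass.mul_apply, X]

theorem mul_X_append (i j : Fin n) (f : Ass k n) (w : List (Fin n)) :
    (f * X i : Ass k n) (w ++ [j]) = if j = i then f w else 0 := by
  rw [Ass.mul_apply, Finset.sum_eq_single w.length]
  · simp [X]
  · intro b hb hb1
    rw [Finset.mem_range, List.length_append, List.length_singleton] at hb
    have : (w ++ [j]).drop b ≠ [i] := fun h => by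
      have := congrArg List.length h
      simp only [List.length_drop, List.length_append, List.length_cons, List.length_nil] at this
      omega
    simp [X, this]
  · simp

/-- The word `w`, as the product of its letters. -/
def monomial (k : Type*) [Field k] {n : ℕ} (w : List (Fin n)) : Ass k n := (w.map X).prod

theorem monomial_nil : monomial k ([] : List (Fin n)) = 1 := rfl

theorem monomial_cons (i : Fin n) (w : List (Fin n)) :
    monomial k (i :: w) = X i * monomial k w := rfl

theorem monomial_append (v w : List (Fin n)) :
    monomial k (v ++ w) = monomial k v * monomial k w := by
  simp [monomial]

theorem monomial_apply (v w : List (Fin n)) : monomial k v w = if w = v then 1 else 0 := by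
  induction v generalizing w with
  | nil => rfl
  | cons i v ih =>
    cases w with
    | nil => rw [monomial_cons, X_mul_nil]; simp
    | cons j w =>
      rw [monomial_cons, X_mul_cons, ih]
      by_cases h : j = i <;> simp [h]

theorem monomial_mem_filtration (w : List (Fin n)) : monomial k w ∈ filtration k n w.length :=
  prod_map_mem_filtration X_mem_filtration w

theorem sum_ite_ofFn_eq {M : Type*} [AddCommMonoid M] (d : ℕ) (w : List (Fin n)) (c : M) :
    ∑ v : Fin d → Fin n, (if List.ofFn v = w then c else 0) = if w.length = d then c else 0 := by
  split_ifs with h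
  · subst h
    rw [Finset.sum_eq_single w.get (fun v _ hv => if_neg fun hvw => hv ?_) (by simp),
      if_pos (List.ofFn_get w)]
    exact List.ofFn_injective (hvw.trans (List.ofFn_get w).symm)
  · exact Finset.sum_eq_zero fun v _ => if_neg fun hv => h (by rw [← hv, List.length_ofFn])

theorem homog_apply (d : ℕ) (f : Ass k n) (w : List (Fin n)) :
    homog d f w = if w.length = d then f w else 0 := rfl

theorem homog_mem_filtration (d : ℕ) (f : Ass k n) : homog d f ∈ filtration k n d :=
  fun _ hw => if_neg hw.ne

theorem seriesSum_homog (f : Ass k n) : (seriesSum fun d => homog d f) = f := by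
  ext w
  simp [seriesSum_apply, homog_apply]

theorem homog_eq_sum_monomial (d : ℕ) (f : Ass k n) :
    homog d f = ∑ v : Fin d → Fin n, f (List.ofFn v) • monomial k (List.ofFn v) := by
  ext w
  rw [homog_apply, ← sum_ite_ofFn_eq, Ass.sum_apply]
  refine Finset.sum_congr rfl fun v _ => ?_
  rw [Ass.smul_apply, monomial_apply, mul_ite, mul_one, mul_zero]
  split_ifs with h h' h'
  · rw [h]
  · exact absurd h.symm h'
  · exact absurd h'.symm h
  · rfl

namespace RaisesDegree

theorem ext_monomial {T S : Ass k m →ₗ[k] Ass k n} (hT : RaisesDegree 0 T) (hS : RaisesDegree 0 S)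
    (h : ∀ w, T (monomial k w) = S (monomial k w)) (f : Ass k m) : T f = S f := by
  rw [← seriesSum_homog f, map_seriesSum hT fun d => homog_mem_filtration d f,
    map_seriesSum hS fun d => homog_mem_filtration d f]
  simp only [homog_eq_sum_monomial, map_sum, map_smul, h]

theorem ext_monomial₂ {B C : Ass k m →ₗ[k] Ass k m →ₗ[k] Ass k n}
    (hB : ∀ f, RaisesDegree 0 (B f)) (hB' : ∀ g, RaisesDegree 0 (B.flip g))
    (hC : ∀ f, RaisesDegree 0 (C f)) (hC' : ∀ g, RaisesDegree 0 (C.flip g))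
    (h : ∀ v w, B (monomial k v) (monomial k w) = C (monomial k v) (monomial k w))
    (f g : Ass k m) : B f g = C f g :=
  (hB' g).ext_monomial (hC' g) (fun v => (hB _).ext_monomial (hC _) (h v) g) f

end RaisesDegree

/-- The continuous linear map with prescribed values on words: `derivation` and `subst` are the
instances that matter. -/
def wordExt (φ : List (Fin m) → Ass k n) : Ass k m →ₗ[k] Ass k n :=
  seriesSum ∘ₗ LinearMap.pi fun d =>
    ∑ v : Fin d → Fin m, (coeff (List.ofFn v)).smulRight (φ (List.ofFn v))

theorem wordExt_apply (φ : List (Fin m) → Ass k n) (f : Ass k m) :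
    wordExt φ f = seriesSum fun d => ∑ v : Fin d → Fin m, f (List.ofFn v) • φ (List.ofFn v) := by
  ext w
  simp [wordExt, seriesSum_apply]

theorem RaisesDegree.wordExt {φ : List (Fin m) → Ass k n} {r : ℕ}
    (hφ : ∀ w, φ w ∈ filtration k n (w.length + r)) : RaisesDegree r (wordExt φ) := fun N f hf => by
  rw [wordExt_apply]
  refine seriesSum_mem_filtration fun d => sum_mem fun v _ => ?_
  by_cases h : d < N
  · rw [hf _ (by simpa using h), zero_smul]
    exact zero_mem _
  · refine Submodule.smul_mem _ _ (filtration_anti ?_ (hφ _))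
    rw [List.length_ofFn]
    omega

theorem wordExt_monomial {φ : List (Fin m) → Ass k n}
    (hφ : ∀ w, φ w ∈ filtration k n w.length) (w : List (Fin m)) :
    wordExt φ (monomial k w) = φ w := by
  have term (d : ℕ) : ∑ v : Fin d → Fin m, monomial k w (List.ofFn v) • φ (List.ofFn v) =
      if w.length = d then φ w else 0 := by
    rw [← sum_ite_ofFn_eq]
    refine Finset.sum_congr rfl fun v _ => ?_
    rw [monomial_apply, ite_smul, one_smul, zero_smul]
    exact ite_congr rfl (fun h => by rw [h]) fun _ => rfl
  rw [wordExt_apply]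
  simp only [term]
  rw [seriesSum_eq_single (N := w.length) (by rw [if_pos rfl]; exact hφ w)
    fun d hd => if_neg hd.symm, if_pos rfl]

/-! ### Continuous derivations -/

/-- Continuous derivations of the algebra of series. Mathlib's `Derivation` requires a commutative
algebra. -/
structure IsDer (D : Module.End k (Ass k n)) : Prop where
  continuous : RaisesDegree 0 D
  leibniz : ∀ f g, D (f * g) = D f * g + f * D g

theorem isDer_zero : IsDer (0 : Module.End k (Ass k n)) where
  continuous _ _ _ := zero_mem _
  leibniz f g := by simp

theorem isDer_ad (a : Ass k n) : IsDer (ad a) where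
  continuous := RaisesDegree.ad (mem_filtration_zero a)
  leibniz f g := by
    simp only [ad_apply]
    noncomm_ring

namespace IsDer

variable {D E : Module.End k (Ass k n)}

theorem map_one (hD : IsDer D) : D 1 = 0 := by
  simpa using hD.leibniz 1 1

theorem map_mem_filtration_one (hD : IsDer D) (f : Ass k n) : D f ∈ filtration k n 1 := by
  have hf : f - f [] • 1 ∈ filtration k n 1 := mem_filtration_one.2 (by simp [Ass.one_apply])
  have h := hD.continuous 1 _ hf
  rwa [map_sub, map_smul, hD.map_one, smul_zero, sub_zero] at h

theorem add (hD : IsDer D) (hE : IsDer E) : IsDer (D + E) where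
  continuous := hD.continuous.add hE.continuous
  leibniz f g := by
    simp only [LinearMap.add_apply, hD.leibniz, hE.leibniz]
    noncomm_ring

theorem sub (hD : IsDer D) (hE : IsDer E) : IsDer (D - E) where
  continuous := hD.continuous.sub hE.continuous
  leibniz f g := by
    simp only [LinearMap.sub_apply, hD.leibniz, hE.leibniz]
    noncomm_ring

theorem commutator (hD : IsDer D) (hE : IsDer E) : IsDer (D * E - E * D) where
  continuous := (hD.continuous.mul hE.continuous).sub (hE.continuous.mul hD.continuous)
  leibniz f g := by
    simp only [LinearMap.sub_apply, Module.End.mul_apply, hD.leibniz, hE.leibniz, map_add]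
    noncomm_ring

end IsDer

theorem wordDer_mem_filtration {r : ℕ} {b : Fin n → Ass k n}
    (hb : ∀ i, b i ∈ filtration k n (r + 1)) (w : List (Fin n)) :
    wordDer b w ∈ filtration k n (w.length + r) := by
  induction w with
  | nil => exact zero_mem _
  | cons i w ih =>
    refine add_mem (filtration_anti ?_ (mul_mem_filtration (hb i) (monomial_mem_filtration w)))
      (filtration_anti ?_ (mul_mem_filtration (X_mem_filtration i) ih)) <;>
    · rw [List.length_cons]
      omega

theorem wordDer_append (b : Fin n → Ass k n) (v w : List (Fin n)) :
    wordDer b (v ++ w) = wordDer b v * monomial k w + monomial k v * wordDer b w := by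
  induction v with
  | nil => simp [wordDer, monomial_nil]
  | cons i v ih =>
    change b i * monomial k (v ++ w) + X i * wordDer b (v ++ w) =
      (b i * monomial k v + X i * wordDer b v) * monomial k w + X i * monomial k v * wordDer b w
    rw [ih, monomial_append]
    noncomm_ring

theorem RaisesDegree.derivation {r : ℕ} {b : Fin n → Ass k n}
    (hb : ∀ i, b i ∈ filtration k n (r + 1)) : RaisesDegree r (derivation b) :=
  RaisesDegree.wordExt (wordDer_mem_filtration hb)

theorem derivation_monomial {b : Fin n → Ass k n} (hb : ∀ i, b i ∈ filtration k n 1)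
    (w : List (Fin n)) : derivation b (monomial k w) = wordDer b w :=
  wordExt_monomial (wordDer_mem_filtration (r := 0) hb) w

theorem derivation_X {b : Fin n → Ass k n} (hb : ∀ i, b i ∈ filtration k n 1) (i : Fin n) :
    derivation b (X i) = b i := by
  simpa [monomial, wordDer] using derivation_monomial hb [i]

theorem isDer_derivation {b : Fin n → Ass k n} (hb : ∀ i, b i ∈ filtration k n 1) :
    IsDer (derivation b) := by
  have hD : RaisesDegree 0 (derivation b) := RaisesDegree.derivation hb
  have left (f : Ass k n) : RaisesDegree 0 (LinearMap.mulLeft k f) :=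
    RaisesDegree.mulLeft (mem_filtration_zero f)
  have right (f : Ass k n) : RaisesDegree 0 (LinearMap.mulRight k f) :=
    RaisesDegree.mulRight (mem_filtration_zero f)
  refine ⟨hD, RaisesDegree.ext_monomial₂ (B := (LinearMap.mul k (Ass k n)).compr₂ (derivation b))
    (C := LinearMap.mul k (Ass k n) ∘ₗ derivation b + (LinearMap.mul k (Ass k n)).compl₂
      (derivation b)) (fun f => hD.comp (left f)) (fun f => hD.comp (right f))
    (fun f => (left (derivation b f)).add ((left f).comp hD))
    (fun f => ((right f).comp hD).add (right (derivation b f))) fun v w => ?_⟩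
  simp only [LinearMap.compr₂_apply, LinearMap.mul_apply', LinearMap.add_apply,
    LinearMap.comp_apply, LinearMap.compl₂_apply]
  rw [← monomial_append]
  simp only [derivation_monomial hb, wordDer_append]

theorem isDer_euler : IsDer (euler : Module.End k (Ass k n)) := isDer_derivation X_mem_filtration

theorem euler_X (i : Fin n) : euler (X i : Ass k n) = X i := derivation_X X_mem_filtration i

theorem euler_monomial (w : List (Fin n)) :
    euler (monomial k w) = (w.length : k) • monomial k w := by
  induction w with
  | nil => rw [monomial_nil, isDer_euler.map_one]; simp
  | cons i w ih =>
    rw [monomial_cons, isDer_euler.leibniz, ih, euler_X, List.length_cons, mul_smul_comm,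
      Nat.cast_succ, add_smul, one_smul, add_comm]

theorem euler_homog (d : ℕ) (f : Ass k n) : euler (homog d f) = (d : k) • homog d f := by
  simp only [homog_eq_sum_monomial, map_sum, map_smul, euler_monomial, List.length_ofFn,
    Finset.smul_sum, smul_comm (d : k)]

theorem euler_apply (f : Ass k n) (w : List (Fin n)) : euler f w = (w.length : k) * f w := by
  have h : euler f = seriesSum fun d => (d : k) • homog d f := by
    simp only [← euler_homog]
    rw [← map_seriesSum isDer_euler.continuous fun d => homog_mem_filtration d f, seriesSum_homog]
  simp [h, seriesSum_apply, homog_apply]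

/-! ### Substitution -/

theorem RaisesDegree.subst {a : Fin m → Ass k n} (ha : ∀ i, a i ∈ filtration k n 1) :
    RaisesDegree 0 (subst a) :=
  RaisesDegree.wordExt (r := 0) (φ := fun w => (w.map a).prod) (prod_map_mem_filtration ha)

theorem subst_monomial {a : Fin m → Ass k n} (ha : ∀ i, a i ∈ filtration k n 1)
    (w : List (Fin m)) : subst a (monomial k w) = (w.map a).prod :=
  wordExt_monomial (prod_map_mem_filtration ha) w

theorem subst_X {a : Fin m → Ass k n} (ha : ∀ i, a i ∈ filtration k n 1) (i : Fin m) :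
    subst a (X i) = a i := by
  simpa [monomial] using subst_monomial ha [i]

theorem subst_mul {a : Fin m → Ass k n} (ha : ∀ i, a i ∈ filtration k n 1) (f g : Ass k m) :
    subst a (f * g) = subst a f * subst a g := by
  have hS := RaisesDegree.subst ha
  refine RaisesDegree.ext_monomial₂ (B := (LinearMap.mul k (Ass k m)).compr₂ (subst a))
    (C := (LinearMap.mul k (Ass k n)).compl₁₂ (subst a) (subst a))
    (fun f => hS.comp (RaisesDegree.mulLeft (mem_filtration_zero f)))
    (fun f => hS.comp (RaisesDegree.mulRight (mem_filtration_zero f)))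
    (fun f => (RaisesDegree.mulLeft (mem_filtration_zero (subst a f))).comp hS)
    (fun f => (RaisesDegree.mulRight (mem_filtration_zero (subst a f))).comp hS)
    (fun v w => ?_) f g
  simp only [LinearMap.compr₂_apply, LinearMap.mul_apply', LinearMap.compl₁₂_apply]
  rw [← monomial_append]
  simp only [subst_monomial ha, List.map_append, List.prod_append]

/-- `subst a` as a homomorphism of algebras. -/
def substAlgHom (a : Fin m → Ass k n) (ha : ∀ i, a i ∈ filtration k n 1) : Ass k m →ₐ[k] Ass k n :=
  AlgHom.ofLinearMap (subst a) (subst_monomial ha []) (subst_mul ha)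

theorem subst_X_eq_self (f : Ass k n) : subst X f = f :=
  (RaisesDegree.subst X_mem_filtration).ext_monomial RaisesDegree.one
    (subst_monomial X_mem_filtration) f

namespace IsDer

variable {D : Module.End k (Ass k n)}

theorem map_subst {E : Module.End k (Ass k m)} {a : Fin m → Ass k n} (hD : IsDer D) (hE : IsDer E)
    (ha : ∀ i, a i ∈ filtration k n 1) (h : ∀ i, D (a i) = subst a (E (X i))) (f : Ass k m) :
    D (subst a f) = subst a (E f) := by
  have hS := RaisesDegree.subst ha
  refine (hD.continuous.comp hS).ext_monomial (hS.comp hE.continuous) (fun w => ?_) f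
  simp only [LinearMap.comp_apply]
  induction w with
  | nil => rw [monomial_nil, hE.map_one, show subst a 1 = 1 from subst_monomial ha [], hD.map_one,
      map_zero]
  | cons i w ih =>
    rw [monomial_cons, subst_mul ha, hD.leibniz, ih, subst_X ha, h, hE.leibniz, map_add,
      subst_mul ha, subst_mul ha, subst_X ha]

theorem ext_X {E : Module.End k (Ass k n)} (hD : IsDer D) (hE : IsDer E)
    (h : ∀ i, D (X i) = E (X i)) : D = E :=
  LinearMap.ext fun f => by
    simpa only [subst_X_eq_self] using
      hD.map_subst hE X_mem_filtration (fun i => by rw [h, subst_X_eq_self]) f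

theorem map_subst_eq_euler_add {z a : Ass k n} (hD : IsDer D) (hz : z ∈ filtration k n 1)
    (h : D z = z + ad z a) (f : Ass k m) :
    D (subst (fun _ => z) f) = subst (fun _ => z) (euler f) + ad (subst (fun _ => z) f) a := by
  have hz' (i : Fin m) : (D + ad a) z = subst (fun _ => z) (euler (X i)) := by
    rw [euler_X, subst_X fun _ => hz, LinearMap.add_apply, h, ad_apply, ad_apply]
    abel
  have key := (hD.add (isDer_ad a)).map_subst isDer_euler (fun _ : Fin m => hz) hz' f
  rw [← key, LinearMap.add_apply, ad_apply, ad_apply]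
  abel

end IsDer

/-! ### Exponentials of operators -/

theorem expEnd_apply (T : Module.End k (Ass k n)) (f : Ass k n) :
    expEnd T f = seriesSum fun d => (d.factorial : k)⁻¹ • (T ^ d) f := by
  ext w
  simp [expEnd, seriesSum_apply]

theorem expSubOneDiv_apply (T : Module.End k (Ass k n)) (f : Ass k n) :
    expSubOneDiv T f = seriesSum fun d => ((d + 1).factorial : k)⁻¹ • (T ^ d) f := by
  ext w
  simp [expSubOneDiv, seriesSum_apply]

theorem RaisesDegree.smul_pow_apply_mem {T : Module.End k (Ass k n)} (hT : RaisesDegree 1 T)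
    (c : ℕ → k) (f : Ass k n) (d : ℕ) : c d • (T ^ d) f ∈ filtration k n d :=
  Submodule.smul_mem _ _ (hT.pow_apply_mem d f)

theorem RaisesDegree.expEnd {T : Module.End k (Ass k n)} (hT : RaisesDegree 1 T) :
    RaisesDegree 0 (expEnd T) := fun N f hf => by
  rw [expEnd_apply]
  exact seriesSum_mem_filtration fun d =>
    Submodule.smul_mem _ _ ((hT.pow d).continuous N f hf)

theorem RaisesDegree.expEnd_sub_one {T : Module.End k (Ass k n)} (hT : RaisesDegree 1 T) :
    RaisesDegree 1 (KV.expEnd T - 1) := fun N f hf => by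
  rw [LinearMap.sub_apply, expEnd_apply, seriesSum_succ (hT.smul_pow_apply_mem _ f)]
  simp only [Nat.factorial_zero, Nat.cast_one, inv_one, one_smul, pow_zero, add_sub_cancel_left]
  refine seriesSum_mem_filtration fun d =>
    Submodule.smul_mem _ _ (filtration_anti (by omega) (hT.pow (d + 1) N f hf))

theorem RaisesDegree.expSubOneDiv {T : Module.End k (Ass k n)} (hT : RaisesDegree 1 T) :
    RaisesDegree 0 (expSubOneDiv T) := fun N f hf => by
  rw [expSubOneDiv_apply]
  exact seriesSum_mem_filtration fun d =>
    Submodule.smul_mem _ _ ((hT.pow d).continuous N f hf)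

theorem expEnd_zero : expEnd (0 : Module.End k (Ass k n)) = 1 := by
  ext1 f
  rw [expEnd_apply, seriesSum_eq_single (N := 0) (mem_filtration_zero _)
    fun d hd => by rw [zero_pow hd, LinearMap.zero_apply, smul_zero]]
  simp

theorem expEnd_apply_expEnd {T S A : Module.End k (Ass k n)} (hT : RaisesDegree 1 T)
    (hS : RaisesDegree 1 S) (hA : RaisesDegree 0 A) (f : Ass k n) :
    expEnd T (A (expEnd S f)) = seriesSum fun d => ∑ x ∈ antidiagonal d,
      ((x.1.factorial : k)⁻¹ * (x.2.factorial : k)⁻¹) • (T ^ x.1 * A * S ^ x.2) f := by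
  have hterm := hS.smul_pow_apply_mem (fun d => (d.factorial : k)⁻¹) f
  have inner (p : ℕ) : (p.factorial : k)⁻¹ • (T ^ p) (A (expEnd S f)) = seriesSum fun q =>
      ((p.factorial : k)⁻¹ * (q.factorial : k)⁻¹) • (T ^ p * A * S ^ q) f := by
    rw [expEnd_apply S, map_seriesSum hA hterm,
      map_seriesSum (hT.pow p).continuous fun q => hA _ _ (hterm q), ← map_smul]
    congr 1
    ext1 q
    simp only [map_smul, Pi.smul_apply, smul_smul, Module.End.mul_apply]
  rw [expEnd_apply T]
  simp only [inner]
  refine seriesSum_seriesSum fun p q => Submodule.smul_mem _ _ ?_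
  rw [add_comm]
  exact hT.pow p _ _ (hA _ _ (hS.pow_apply_mem q f))

theorem sum_inv_factorial_smul_pow_mul_pow [CharZero k] {R : Type*} [Ring R] [Algebra k R]
    {x y : R} (h : Commute x y) (d : ℕ) :
    ∑ p ∈ antidiagonal d, ((p.1.factorial : k)⁻¹ * (p.2.factorial : k)⁻¹) • (x ^ p.1 * y ^ p.2) =
      (d.factorial : k)⁻¹ • (x + y) ^ d := by
  rw [h.add_pow', Finset.smul_sum]
  refine Finset.sum_congr rfl fun p hp => ?_
  rw [← Finset.HasAntidiagonal.mem_antidiagonal.1 hp, ← Nat.cast_smul_eq_nsmul k, smul_smul,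
    Nat.cast_add_choose]
  congr 1
  have := Nat.cast_ne_zero (R := k).2 (p.1 + p.2).factorial_ne_zero
  field_simp

theorem expEnd_mul_expEnd [CharZero k] {T S : Module.End k (Ass k n)} (hT : RaisesDegree 1 T)
    (hS : RaisesDegree 1 S) (h : Commute T S) : expEnd T * expEnd S = expEnd (T + S) := by
  ext1 f
  have key := expEnd_apply_expEnd hT hS RaisesDegree.one f
  rw [Module.End.mul_apply, expEnd_apply (T + S)]
  simp only [mul_one, Module.End.one_apply, ← LinearMap.smul_apply, ← LinearMap.sum_apply,
    sum_inv_factorial_smul_pow_mul_pow h] at key ⊢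
  exact key

theorem expEnd_neg_expEnd [CharZero k] {T : Module.End k (Ass k n)} (hT : RaisesDegree 1 T)
    (f : Ass k n) : expEnd (-T) (expEnd T f) = f := by
  rw [← Module.End.mul_apply, expEnd_mul_expEnd hT.neg hT (Commute.refl T).neg_left,
    neg_add_cancel, expEnd_zero, Module.End.one_apply]

theorem expEnd_expEnd_neg [CharZero k] {T : Module.End k (Ass k n)} (hT : RaisesDegree 1 T)
    (f : Ass k n) : expEnd T (expEnd (-T) f) = f := by
  simpa only [neg_neg] using expEnd_neg_expEnd hT.neg f

/-- The commutator `E ↦ W E - E W` with an operator `W`. -/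
def adEnd (W : Module.End k (Ass k n)) : Module.End k (Module.End k (Ass k n)) :=
  LinearMap.mulLeft k W + LinearMap.mulRight k (-W)

theorem adEnd_apply (W E : Module.End k (Ass k n)) : adEnd W E = W * E - E * W := by
  simp [adEnd, sub_eq_add_neg]

theorem expEnd_conj [CharZero k] {W E : Module.End k (Ass k n)} (hW : RaisesDegree 1 W)
    (hE : RaisesDegree 0 E) (f : Ass k n) :
    expEnd W (E (expEnd (-W) f)) =
      seriesSum fun d => (d.factorial : k)⁻¹ • (adEnd W ^ d) E f := by
  rw [expEnd_apply_expEnd hW hW.neg hE]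
  congr 1
  ext1 d
  rw [← LinearMap.smul_apply, ← LinearMap.smul_apply, adEnd,
    ← sum_inv_factorial_smul_pow_mul_pow (LinearMap.commute_mulLeft_right W (-W)),
    LinearMap.sum_apply, LinearMap.sum_apply]
  simp [LinearMap.pow_mulLeft, LinearMap.pow_mulRight, mul_assoc]

namespace IsDer

variable {D : Module.End k (Ass k n)}

theorem adEnd_pow_mulLeft (hD : IsDer D) (f : Ass k n) (d : ℕ) :
    (adEnd D ^ d) (LinearMap.mulLeft k f) = LinearMap.mulLeft k ((D ^ d) f) := by
  induction d with
  | zero => rfl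
  | succ d ih =>
    rw [pow_succ', Module.End.mul_apply, ih, adEnd_apply, pow_succ', Module.End.mul_apply]
    ext1 g
    simp [hD.leibniz]

theorem expEnd_mul [CharZero k] (hD : IsDer D) (hD1 : RaisesDegree 1 D) (f g : Ass k n) :
    expEnd D (f * g) = expEnd D f * expEnd D g := by
  have conj := expEnd_conj hD1 (RaisesDegree.mulLeft (mem_filtration_zero f)) (expEnd D g)
  have right := map_seriesSum (RaisesDegree.mulRight (mem_filtration_zero (expEnd D g)))
    (hD1.smul_pow_apply_mem (fun d => (d.factorial : k)⁻¹) f)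
  simp only [hD.adEnd_pow_mulLeft, LinearMap.mulLeft_apply, expEnd_neg_expEnd hD1] at conj
  simp only [← expEnd_apply, LinearMap.mulRight_apply, smul_mul_assoc] at right
  rw [conj, right]

theorem expEnd_one (hD : IsDer D) : expEnd D 1 = 1 := by
  rw [expEnd_apply, seriesSum_eq_single (N := 0) (mem_filtration_zero _)]
  · simp
  · intro d hd
    obtain ⟨e, rfl⟩ := Nat.exists_eq_succ_of_ne_zero hd
    rw [pow_succ, Module.End.mul_apply, hD.map_one, map_zero, smul_zero]

/-- The automorphism `e^D` as a homomorphism of algebras. -/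
def expAlgHom [CharZero k] (hD : IsDer D) (hD1 : RaisesDegree 1 D) : Ass k n →ₐ[k] Ass k n :=
  AlgHom.ofLinearMap (expEnd D) hD.expEnd_one (hD.expEnd_mul hD1)

end IsDer

/-! ### Exponential and logarithm -/

theorem pow_smul_mem_filtration {a : Ass k n} (ha : a ∈ filtration k n 1) (c : ℕ → k) (d : ℕ) :
    c d • a ^ d ∈ filtration k n d :=
  Submodule.smul_mem _ _ (pow_mem_filtration ha d)

theorem expA_sub_mem_filtration {a : Ass k n} (ha : a ∈ filtration k n 1) :
    expA a - (1 + a) ∈ filtration k n 2 := by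
  simpa [Finset.sum_range_succ, expA] using
    seriesSum_sub_sum_range_mem (pow_smul_mem_filtration ha fun d => (d.factorial : k)⁻¹) 2

theorem expA_sub_one_mem_filtration {a : Ass k n} (ha : a ∈ filtration k n 1) :
    expA a - 1 ∈ filtration k n 1 := by
  have h := add_mem (filtration_anti one_le_two (expA_sub_mem_filtration ha)) ha
  rwa [sub_add_eq_sub_sub, sub_add_cancel] at h

theorem map_expA {φ : Ass k m →ₐ[k] Ass k n} (hφ : RaisesDegree 0 φ.toLinearMap) {a : Ass k m}
    (ha : a ∈ filtration k m 1) : φ (expA a) = expA (φ a) := by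
  simpa only [expA, AlgHom.toLinearMap_apply, map_smul, map_pow] using
    map_seriesSum hφ (pow_smul_mem_filtration ha fun d => (d.factorial : k)⁻¹)

theorem expEnd_mulLeft {a : Ass k n} (ha : a ∈ filtration k n 1) (f : Ass k n) :
    expEnd (LinearMap.mulLeft k a) f = expA a * f := by
  simpa [expA, expEnd_apply, LinearMap.pow_mulLeft] using
    (map_seriesSum (RaisesDegree.mulRight (mem_filtration_zero f))
      (pow_smul_mem_filtration ha fun d => (d.factorial : k)⁻¹)).symm

theorem expEnd_mulRight {a : Ass k n} (ha : a ∈ filtration k n 1) (f : Ass k n) :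
    expEnd (LinearMap.mulRight k a) f = f * expA a := by
  simpa [expA, expEnd_apply, LinearMap.pow_mulRight] using
    (map_seriesSum (RaisesDegree.mulLeft (mem_filtration_zero f))
      (pow_smul_mem_filtration ha fun d => (d.factorial : k)⁻¹)).symm

theorem mulLeft_neg (a : Ass k n) : LinearMap.mulLeft k (-a) = -LinearMap.mulLeft k a := by
  ext1 f
  simp

theorem expA_neg_mul [CharZero k] {a : Ass k n} (ha : a ∈ filtration k n 1) :
    expA (-a) * expA a = 1 := by
  have h := expEnd_neg_expEnd (RaisesDegree.mulLeft ha) 1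
  rwa [← mulLeft_neg, expEnd_mulLeft ha, expEnd_mulLeft (neg_mem ha), mul_one] at h

theorem expA_mul_neg [CharZero k] {a : Ass k n} (ha : a ∈ filtration k n 1) :
    expA a * expA (-a) = 1 := by
  simpa only [neg_neg] using expA_neg_mul (neg_mem ha)

theorem isUnit_expA [CharZero k] {a : Ass k n} (ha : a ∈ filtration k n 1) : IsUnit (expA a) :=
  ⟨⟨expA a, expA (-a), expA_mul_neg ha, expA_neg_mul ha⟩, rfl⟩

theorem expEnd_ad [CharZero k] {a : Ass k n} (ha : a ∈ filtration k n 1) (f : Ass k n) :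
    expEnd (ad a) f = expA a * f * expA (-a) := by
  have h : ad a = LinearMap.mulLeft k a + LinearMap.mulRight k (-a) := by
    ext1 f
    simp [ad_apply, sub_eq_add_neg]
  rw [h, ← expEnd_mul_expEnd (RaisesDegree.mulLeft ha) (RaisesDegree.mulRight (neg_mem ha))
    (LinearMap.commute_mulLeft_right a (-a)), Module.End.mul_apply, expEnd_mulRight (neg_mem ha),
    expEnd_mulLeft ha, mul_assoc]

theorem commute_seriesSum {a : Ass k n} {c : ℕ → Ass k n} (hc : ∀ d, c d ∈ filtration k n d)
    (h : ∀ d, Commute a (c d)) : Commute a (seriesSum c) := by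
  have left := map_seriesSum (RaisesDegree.mulLeft (r := 0) (mem_filtration_zero a)) hc
  have right := map_seriesSum (RaisesDegree.mulRight (r := 0) (mem_filtration_zero a)) hc
  simp only [LinearMap.mulLeft_apply, LinearMap.mulRight_apply] at left right
  rw [Commute, SemiconjBy, left, right]
  exact congrArg seriesSum (funext h)

theorem commute_expA {a : Ass k n} (ha : a ∈ filtration k n 1) : Commute a (expA a) :=
  commute_seriesSum (pow_smul_mem_filtration ha fun d => (d.factorial : k)⁻¹)
    fun d => ((Commute.refl a).pow_right d).smul_right _

theorem logA_term_mem {g : Ass k n} (hg : g - 1 ∈ filtration k n 1) (d : ℕ) :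
    ((-1 : k) ^ d / ((d : k) + 1)) • (g - 1) ^ (d + 1) ∈ filtration k n (d + 1) :=
  Submodule.smul_mem _ _ (pow_mem_filtration hg (d + 1))

theorem logA_term_mem' {g : Ass k n} (hg : g - 1 ∈ filtration k n 1) (d : ℕ) :
    ((-1 : k) ^ d / ((d : k) + 1)) • (g - 1) ^ (d + 1) ∈ filtration k n d :=
  filtration_anti d.le_succ (logA_term_mem hg d)

theorem logA_mem_filtration {g : Ass k n} (hg : g - 1 ∈ filtration k n 1) :
    logA g ∈ filtration k n 1 :=
  seriesSum_mem_filtration fun d =>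
    filtration_anti (Nat.succ_le_succ d.zero_le) (logA_term_mem hg d)

theorem map_logA {φ : Ass k m →ₐ[k] Ass k n} (hφ : RaisesDegree 0 φ.toLinearMap) {g : Ass k m}
    (hg : g - 1 ∈ filtration k m 1) : φ (logA g) = logA (φ g) := by
  simpa only [logA, AlgHom.toLinearMap_apply, map_smul, map_pow, map_sub, map_one] using
    map_seriesSum hφ (logA_term_mem' hg)

theorem commute_logA {g a : Ass k n} (hg : g - 1 ∈ filtration k n 1) (h : Commute a g) :
    Commute a (logA g) :=
  commute_seriesSum (logA_term_mem' hg) fun _ =>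
    ((h.sub_right (Commute.one_right a)).pow_right _).smul_right _

namespace IsDer

variable {D : Module.End k (Ass k n)}

theorem map_pow_succ (hD : IsDer D) {c : Ass k n} (h : Commute c (D c)) (d : ℕ) :
    D (c ^ (d + 1)) = ((d : k) + 1) • (c ^ d * D c) := by
  induction d with
  | zero => simp
  | succ d ih =>
    rw [pow_succ', hD.leibniz, ih, mul_smul_comm, ← mul_assoc, ← pow_succ',
      ← (h.pow_left (d + 1)).eq, Nat.cast_succ, add_smul ((d : k) + 1), one_smul, add_comm]

theorem map_expA [CharZero k] (hD : IsDer D) {c : Ass k n} (hc : c ∈ filtration k n 1)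
    (h : Commute c (D c)) : D (expA c) = expA c * D c := by
  have hterm := pow_smul_mem_filtration hc fun d => (d.factorial : k)⁻¹
  have right := map_seriesSum (RaisesDegree.mulRight (mem_filtration_zero (D c))) hterm
  simp only [LinearMap.mulRight_apply] at right
  rw [expA, map_seriesSum hD.continuous hterm, right,
    seriesSum_succ fun d => hD.continuous _ _ (hterm d)]
  simp only [pow_zero, map_smul, hD.map_one, smul_zero, zero_add]
  congr 1
  ext1 d
  rw [hD.map_pow_succ h, smul_smul, smul_mul_assoc, Nat.factorial_succ]
  congr 1
  have := Nat.cast_ne_zero (R := k).2 d.factorial_ne_zero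
  have := Nat.cast_add_one_ne_zero (R := k) d
  push_cast
  field_simp

theorem mul_map_logA [CharZero k] (hD : IsDer D) {g : Ass k n} (hg : g - 1 ∈ filtration k n 1)
    (h : Commute g (D g)) : g * D (logA g) = D g := by
  obtain ⟨z, rfl⟩ : ∃ z, g = 1 + z := ⟨g - 1, by abel⟩
  rw [add_sub_cancel_left] at hg
  rw [map_add, hD.map_one, zero_add] at h ⊢
  have hcomm : Commute z (D z) := by simpa using h.sub_left (Commute.one_left _)
  have hz : RaisesDegree 0 (LinearMap.mulLeft k z) := RaisesDegree.mulLeft (mem_filtration_zero z)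
  let geom : ℕ → Ass k n := fun d => (-1 : k) ^ d • (z ^ d * D z)
  have hgeom (d : ℕ) : geom d ∈ filtration k n d :=
    Submodule.smul_mem _ _ (mul_mem_filtration (pow_mem_filtration hg d) (mem_filtration_zero _))
  have deriv : D (logA (1 + z)) = seriesSum geom := by
    rw [logA, map_seriesSum hD.continuous (logA_term_mem' (by rwa [add_sub_cancel_left]))]
    congr 1
    ext1 d
    rw [map_smul, add_sub_cancel_left, hD.map_pow_succ hcomm, smul_smul,
      div_mul_cancel₀ _ (Nat.cast_add_one_ne_zero d)]
  have shift : z * seriesSum geom = -seriesSum fun d => geom (d + 1) := by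
    rw [← LinearMap.mulLeft_apply k, map_seriesSum hz hgeom, ← map_neg]
    congr 1
    ext1 d
    simp [geom, ← mul_assoc, pow_succ']
  rw [deriv, add_mul, one_mul, shift, seriesSum_succ hgeom, add_neg_cancel_right]
  simp [geom]

end IsDer

theorem eq_zero_of_euler_eq_zero [CharZero k] {f : Ass k n} (hf : f ∈ filtration k n 1)
    (h : euler f = 0) : f = 0 := by
  ext w
  rcases eq_or_ne w [] with rfl | hw
  · exact mem_filtration_one.1 hf
  · have hw' := congrArg (coeff w) h
    rw [coeff_apply, euler_apply, map_zero, mul_eq_zero, Nat.cast_eq_zero,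
      List.length_eq_zero_iff] at hw'
    exact hw'.resolve_left hw

/-- `g e^{-ln g} - 1` is killed by `euler`. -/
theorem expA_logA_one_add_X [CharZero k] : expA (logA (1 + X 0 : Ass k 1)) = 1 + X 0 := by
  set g : Ass k 1 := 1 + X 0 with hg_def
  have hg : g - 1 ∈ filtration k 1 1 := by
    rw [hg_def, add_sub_cancel_left]
    exact X_mem_filtration 0
  set c := logA g
  have hc : c ∈ filtration k 1 1 := logA_mem_filtration hg
  have hderiv : euler (g * expA (-c)) = 0 := by
    rw [isDer_euler.leibniz, isDer_euler.map_expA (neg_mem hc) (Ass.mul_comm_one _ _),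
      ← isDer_euler.mul_map_logA hg (Ass.mul_comm_one _ _), Ass.mul_comm_one (expA _), ← mul_assoc,
      ← add_mul, map_neg, mul_neg, add_neg_cancel, zero_mul]
  have hconst : g * expA (-c) - 1 ∈ filtration k 1 1 := by
    have h := add_mem (mul_mem_filtration hg (mem_filtration_zero (expA (-c))))
      (expA_sub_one_mem_filtration (neg_mem hc))
    rwa [sub_mul, one_mul, sub_add_sub_cancel] at h
  have hone : g * expA (-c) = 1 := sub_eq_zero.1 <|
    eq_zero_of_euler_eq_zero hconst (by rw [map_sub, hderiv, isDer_euler.map_one, sub_zero])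
  calc expA c = g * expA (-c) * expA c := by rw [hone, one_mul]
    _ = g := by rw [mul_assoc, expA_neg_mul hc, mul_one]

theorem expA_logA [CharZero k] {g : Ass k n} (hg : g - 1 ∈ filtration k n 1) :
    expA (logA g) = g := by
  have hX : (1 + X 0 : Ass k 1) - 1 ∈ filtration k 1 1 := by
    rw [add_sub_cancel_left]
    exact X_mem_filtration 0
  have hg' : ∀ _ : Fin 1, g - 1 ∈ filtration k n 1 := fun _ => hg
  let φ := substAlgHom (fun _ : Fin 1 => g - 1) hg'
  have hφ : RaisesDegree 0 φ.toLinearMap := RaisesDegree.subst hg'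
  have hφX : φ (1 + X 0) = g := by
    rw [map_add, map_one, show φ (X 0) = g - 1 from subst_X hg' 0, add_sub_cancel]
  have h := congrArg φ (expA_logA_one_add_X (k := k))
  rwa [map_expA hφ (logA_mem_filtration hX), map_logA hφ hX, hφX] at h

/-! ### The Campbell-Hausdorff series -/

theorem expA_mul_expA_sub_one_mem {a b : Ass k n} (ha : a ∈ filtration k n 1)
    (hb : b ∈ filtration k n 1) : expA a * expA b - 1 ∈ filtration k n 1 := by
  have h := add_mem (mul_mem_filtration (expA_sub_one_mem_filtration ha)
    (mem_filtration_zero (expA b))) (expA_sub_one_mem_filtration hb)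
  rwa [sub_mul, one_mul, sub_add_sub_cancel] at h

theorem ch_mem_filtration {a b : Ass k n} (ha : a ∈ filtration k n 1)
    (hb : b ∈ filtration k n 1) : ch a b ∈ filtration k n 1 :=
  logA_mem_filtration (expA_mul_expA_sub_one_mem ha hb)

theorem expA_ch [CharZero k] {a b : Ass k n} (ha : a ∈ filtration k n 1)
    (hb : b ∈ filtration k n 1) : expA (ch a b) = expA a * expA b :=
  expA_logA (expA_mul_expA_sub_one_mem ha hb)

theorem ch_sub_add_mem_filtration [CharZero k] {a b : Ass k n} (ha : a ∈ filtration k n 1)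
    (hb : b ∈ filtration k n 1) : ch a b - (a + b) ∈ filtration k n 2 := by
  have h : ch a b - (a + b) = (expA a - 1) * (expA b - 1) + (expA a - (1 + a)) +
      (expA b - (1 + b)) - (expA (ch a b) - (1 + ch a b)) := by
    rw [expA_ch ha hb]
    noncomm_ring
  rw [h]
  exact sub_mem (add_mem (add_mem (mul_mem_filtration (expA_sub_one_mem_filtration ha)
    (expA_sub_one_mem_filtration hb)) (expA_sub_mem_filtration ha)) (expA_sub_mem_filtration hb))
    (expA_sub_mem_filtration (ch_mem_filtration ha hb))

theorem ch_swap [CharZero k] {a b : Ass k n} (ha : a ∈ filtration k n 1)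
    (hb : b ∈ filtration k n 1) : expA (-a) * ch a b * expA a = ch b a := by
  have had : RaisesDegree 1 (ad (-a)) := RaisesDegree.ad (neg_mem ha)
  let φ := (isDer_ad (-a)).expAlgHom had
  have hφ (f : Ass k n) : φ f = expA (-a) * f * expA a :=
    (expEnd_ad (neg_mem ha) f).trans (by rw [neg_neg])
  have hφ₀ : RaisesDegree 0 φ.toLinearMap := had.expEnd
  rw [← hφ, ch, map_logA hφ₀ (expA_mul_expA_sub_one_mem ha hb), hφ, ← mul_assoc,
    expA_neg_mul ha, one_mul, ch]

theorem ad_neg (a : Ass k n) : ad (-a) = -ad a := by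
  ext1 f
  simp [ad_apply, add_comm, ← sub_eq_add_neg]

namespace IsDer

variable {D : Module.End k (Ass k n)}

theorem map_logA_eq_neg_iff [CharZero k] (hD : IsDer D) {g : Ass k n}
    (hg : g - 1 ∈ filtration k n 1) : D (logA g) = -logA g ↔ D g = -(logA g * g) := by
  have hcomm : Commute g (logA g) := commute_logA hg (Commute.refl g)
  have hunit : IsUnit g := expA_logA hg ▸ isUnit_expA (logA_mem_filtration hg)
  constructor
  · intro h
    have h' := hD.map_expA (logA_mem_filtration hg) (by rw [h]; exact (Commute.refl _).neg_right)
    rwa [expA_logA hg, h, mul_neg, hcomm.eq] at h'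
  · intro h
    have h' := hD.mul_map_logA hg (by rw [h]; exact (hcomm.mul_right (Commute.refl g)).neg_right)
    rwa [h, ← hcomm.eq, ← mul_neg, hunit.mul_right_inj] at h'

variable {x y a b : Ass k n}

/-- `D + ad a` multiplies `x` by `-1`. -/
theorem map_expA_of_map_eq [CharZero k] (hD : IsDer D) (hx : x ∈ filtration k n 1)
    (h : D x = ad x a - x) : D (expA x) = ad (expA x) a - expA x * x := by
  have hx' : (D + ad a) x = -x := by
    rw [LinearMap.add_apply, h, ad_apply, ad_apply]
    abel
  have h' := (hD.add (isDer_ad a)).map_expA hx (by rw [hx']; exact (Commute.refl x).neg_right)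
  rw [hx', LinearMap.add_apply, ad_apply] at h'
  rw [eq_sub_of_add_eq h', ad_apply]
  noncomm_ring

theorem expA_neg_mul_map_expA [CharZero k] (hD : IsDer D) (hx : x ∈ filtration k n 1)
    (h : D x = ad x a - x) : expA (-x) * D (expA x) = (1 - expEnd (-ad x)) a - x := by
  rw [hD.map_expA_of_map_eq hx h, LinearMap.sub_apply, Module.End.one_apply, ← ad_neg,
    expEnd_ad (neg_mem hx), neg_neg, ad_apply, mul_sub, mul_sub]
  simp only [← mul_assoc, expA_neg_mul hx, one_mul]

theorem map_expA_mul_expA_neg [CharZero k] (hD : IsDer D) (hx : x ∈ filtration k n 1)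
    (h : D x = ad x a - x) : D (expA x) * expA (-x) = (expEnd (ad x) - 1) a - x := by
  rw [hD.map_expA_of_map_eq hx h, LinearMap.sub_apply, Module.End.one_apply, expEnd_ad hx,
    ad_apply, ← (commute_expA hx).eq, sub_mul, sub_mul]
  simp only [mul_assoc, expA_mul_neg hx, mul_one]

theorem map_ch_eq_neg_iff [CharZero k] (hD : IsDer D) (hx : x ∈ filtration k n 1)
    (hy : y ∈ filtration k n 1) (hDx : D x = ad x a - x) (hDy : D y = ad y b - y) :
    D (ch x y) = -ch x y ↔
      x + y - ch y x = (1 - expEnd (-ad x)) a + (expEnd (ad y) - 1) b := by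
  have lhs : expA (-x) * D (expA x * expA y) * expA (-y) =
      (1 - expEnd (-ad x)) a - x + ((expEnd (ad y) - 1) b - y) := by
    rw [← hD.expA_neg_mul_map_expA hx hDx, ← hD.map_expA_mul_expA_neg hy hDy, hD.leibniz]
    simp only [mul_add, add_mul, mul_assoc, expA_mul_neg hy, mul_one]
    simp only [← mul_assoc, expA_neg_mul hx, one_mul]
  have rhs : expA (-x) * -(ch x y * (expA x * expA y)) * expA (-y) = -ch y x := by
    rw [← ch_swap hx hy]
    simp only [mul_neg, neg_mul, mul_assoc, expA_mul_neg hy, mul_one]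
  rw [ch, hD.map_logA_eq_neg_iff (expA_mul_expA_sub_one_mem hx hy), ← ch,
    ← (isUnit_expA (neg_mem hx)).mul_right_inj, ← (isUnit_expA (neg_mem hy)).mul_left_inj, lhs, rhs]
  constructor <;> intro h
  · rw [eq_neg_iff_add_eq_zero] at h
    rw [← sub_eq_zero, ← neg_eq_zero, ← h]
    abel
  · rw [eq_neg_iff_add_eq_zero, ← sub_eq_zero.2 h.symm]
    abel

end IsDer

/-! ### The completed free Lie algebra -/

theorem homog_mul_homog_apply (p q : ℕ) (f g : Ass k n) (w : List (Fin n)) :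
    (homog p f * homog q g) w = if w.length = p + q then f (w.take p) * g (w.drop p) else 0 := by
  rw [Ass.mul_apply]
  simp only [homog_apply, List.length_take, List.length_drop, ← ite_and, ite_mul, mul_ite,
    zero_mul, mul_zero]
  split_ifs with hw
  · rw [Finset.sum_eq_single p (fun i hi hip => ?_) fun hp => ?_, if_pos (by omega)]
    · rw [Finset.mem_range] at hi
      exact if_neg (by omega)
    · rw [Finset.mem_range] at hp
      omega
  · refine Finset.sum_eq_zero fun i hi => if_neg ?_
    rw [Finset.mem_range] at hi
    omega

theorem homog_mul (d : ℕ) (f g : Ass k n) :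
    homog d (f * g) = ∑ p ∈ antidiagonal d, homog p.1 f * homog p.2 g := by
  ext w
  have hsum : ∑ p ∈ antidiagonal d, (homog p.1 f * homog p.2 g) w = ∑ p ∈ antidiagonal d,
      if w.length = d then f (w.take p.1) * g (w.drop p.1) else 0 :=
    Finset.sum_congr rfl fun p hp => by
      rw [homog_mul_homog_apply, Finset.HasAntidiagonal.mem_antidiagonal.1 hp]
  rw [homog_apply, Ass.sum_apply, hsum]
  split_ifs with hw
  · rw [Ass.mul_apply, hw, Finset.Nat.sum_antidiagonal_eq_sum_range_succ_mk]
  · exact Finset.sum_const_zero.symm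

theorem homog_ad (d : ℕ) (f g : Ass k n) :
    homog d (ad f g) = ∑ p ∈ antidiagonal d, ad (homog p.1 f) (homog p.2 g) := by
  rw [ad_apply, map_sub, homog_mul, homog_mul,
    ← Finset.Nat.sum_antidiagonal_swap (f := fun p : ℕ × ℕ => homog p.1 g * homog p.2 f),
    ← Finset.sum_sub_distrib]
  rfl

theorem homog_X (d : ℕ) (i : Fin n) : homog d (X i : Ass k n) = if d = 1 then X i else 0 := by
  ext w
  rw [homog_apply, X]
  split_ifs with hw hd hd
  · rfl
  · rw [Ass.of_apply, if_neg fun h => hd (by rw [← hw, h, List.length_singleton]), Ass.zero_apply]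
  · rw [Ass.of_apply, if_neg fun h => hw (by rw [hd, h, List.length_singleton])]
  · rfl

section

attribute [local instance 100] LieRing.ofAssociativeRing

theorem ad_mem_liePoly {f g : Ass k n} (hf : f ∈ liePoly k n) (hg : g ∈ liePoly k n) :
    ad f g ∈ liePoly k n := (liePoly k n).lie_mem hf hg

theorem X_mem_liePoly (i : Fin n) : X i ∈ liePoly k n :=
  LieSubalgebra.subset_lieSpan ⟨i, rfl⟩

theorem mem_of_mem_liePoly {V : Submodule k (Ass k n)} (hX : ∀ i, X i ∈ V)
    (had : ∀ f ∈ V, ∀ g ∈ V, ad f g ∈ V) {f : Ass k n} (hf : f ∈ liePoly k n) : f ∈ V := by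
  induction hf using LieSubalgebra.lieSpan_induction with
  | mem x hx => obtain ⟨i, rfl⟩ := hx; exact hX i
  | zero => exact zero_mem _
  | smul c x _ h => exact Submodule.smul_mem _ c h
  | add x y _ _ hx hy => exact add_mem hx hy
  | lie x y _ _ hx hy => exact had x hx y hy

theorem mem_lie {f : Ass k n} : f ∈ lie k n ↔ ∀ d, homog d f ∈ (liePoly k n).toSubmodule := by
  simp [lie]

end

theorem ad_mem_lie {f g : Ass k n} (hf : f ∈ lie k n) (hg : g ∈ lie k n) : ad f g ∈ lie k n :=
  mem_lie.2 fun d => by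
    rw [homog_ad]
    exact sum_mem fun p _ => ad_mem_liePoly (mem_lie.1 hf p.1) (mem_lie.1 hg p.2)

theorem X_mem_lie (i : Fin n) : X i ∈ lie k n :=
  mem_lie.2 fun d => by
    rw [homog_X]
    split_ifs
    · exact X_mem_liePoly i
    · exact zero_mem _

theorem seriesSum_mem_lie {c : ℕ → Ass k n} (hc : ∀ d, c d ∈ lie k n) : seriesSum c ∈ lie k n := by
  refine mem_lie.2 fun d => ?_
  have h : homog d (seriesSum c) = ∑ e ∈ Finset.range (d + 1), homog d (c e) := by
    ext w
    simp only [Ass.sum_apply, homog_apply, seriesSum_apply]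
    split_ifs with hw
    · rw [hw]
    · exact Finset.sum_const_zero.symm
  rw [h]
  exact sum_mem fun e _ => mem_lie.1 (hc e) d

theorem IsDer.map_ad {D : Module.End k (Ass k n)} (hD : IsDer D) (f g : Ass k n) :
    D (ad f g) = ad (D f) g + ad f (D g) := by
  simp only [ad_apply, map_sub, hD.leibniz]
  noncomm_ring

theorem IsDer.map_mem_lie {D : Module.End k (Ass k n)} (hD : IsDer D)
    (hX : ∀ i, D (X i) ∈ lie k n) {f : Ass k n} (hf : f ∈ lie k n) : D f ∈ lie k n := by
  have hpoly {p : Ass k n} (hp : p ∈ liePoly k n) : p ∈ lie k n ⊓ (lie k n).comap D := by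
    refine mem_of_mem_liePoly (fun i => Submodule.mem_inf.2 ⟨X_mem_lie i, hX i⟩) ?_ hp
    rintro p ⟨hp, hDp⟩ q ⟨hq, hDq⟩
    refine ⟨ad_mem_lie hp hq, ?_⟩
    rw [Submodule.comap_coe, Set.mem_preimage, hD.map_ad]
    exact add_mem (ad_mem_lie hDp hq) (ad_mem_lie hp hDq)
  rw [← seriesSum_homog f, map_seriesSum hD.continuous fun d => homog_mem_filtration d f]
  exact seriesSum_mem_lie fun d => (hpoly (mem_lie.1 hf d)).2

theorem apply_replicate_eq_zero_of_mem_lie {f : Ass k n} (hf : f ∈ lie k n) (i : Fin n) {d : ℕ}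
    (hd : d ≠ 1) : f (List.replicate d i) = 0 := by
  have hV : homog d f ∈ LinearMap.ker (coeff (List.replicate d i)) := by
    refine mem_of_mem_liePoly (fun j => ?_) (fun p _ q _ => ?_) (mem_lie.1 hf d)
    · exact if_neg fun h => hd (by simpa using congrArg List.length h)
    · rw [LinearMap.mem_ker, coeff_apply, ad_apply, Ass.sub_apply, sub_eq_zero, Ass.mul_apply,
        Ass.mul_apply, ← Finset.sum_range_reflect]
      refine Finset.sum_congr rfl fun j hj => ?_
      simp only [List.length_replicate, Finset.mem_range] at hj ⊢
      rw [List.take_replicate, List.take_replicate, List.drop_replicate, List.drop_replicate,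
        mul_comm]
      congr 3 <;> omega
  simpa [homog_apply] using hV

theorem mem_filtration_one_of_mem_lie {f : Ass k n} (hf : f ∈ lie k n) : f ∈ filtration k n 1 := by
  have hV : homog 0 f ∈ filtration k n 1 :=
    mem_of_mem_liePoly X_mem_filtration
      (fun p _ q hq => RaisesDegree.ad (mem_filtration_zero p) 1 q hq) (mem_lie.1 hf 0)
  exact mem_filtration_one.2 (by simpa [homog_apply] using mem_filtration_one.1 hV)

/-- A final letter `x_i` can be moved to the front of a word without changing the coefficient, until
the word ends in another letter. -/
theorem apply_eq_zero_of_ad_X_eq_zero {i : Fin n} {f : Ass k n} (h : ad (X i) f = 0)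
    {w : List (Fin n)} (hw : ∃ j ∈ w, j ≠ i) : f w = 0 := by
  have shift (v : List (Fin n)) (j : Fin n) : f (v ++ [j]) = if j = i then f (i :: v) else 0 := by
    have hcomm : X i * f = f * X i := sub_eq_zero.1 h
    rw [← mul_X_append i j f (i :: v), ← hcomm, List.cons_append, X_mul_cons, if_pos rfl]
  have key (v : List (Fin n)) : ∀ d, (∃ j ∈ v, j ≠ i) → f (List.replicate d i ++ v) = 0 := by
    induction v using List.reverseRecOn with
    | nil => rintro d ⟨j, hj, _⟩; simp at hj
    | append_singleton v l ih =>
      rintro d ⟨j, hj, hji⟩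
      rw [← List.append_assoc, shift]
      split_ifs with hl
      · rw [List.mem_append, List.mem_singleton] at hj
        exact ih (d + 1) ⟨j, hj.resolve_right fun hjl => hji (hjl.trans hl), hji⟩
      · rfl
  exact key w 0 hw

theorem eq_zero_of_ad_X_eq_zero {i : Fin n} {f : Ass k n} (hf : f ∈ lie k n) (hi : f [i] = 0)
    (h : ad (X i) f = 0) : f = 0 := by
  ext w
  by_cases hw : ∃ j ∈ w, j ≠ i
  · exact apply_eq_zero_of_ad_X_eq_zero h hw
  · push Not at hw
    rw [List.eq_replicate_of_mem hw]
    by_cases hl : w.length = 1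
    · rw [hl]
      exact hi
    · exact apply_replicate_eq_zero_of_mem_lie hf i hl

/-! ### Tangential derivations -/

/-- The derivation `x_i ↦ [x_i, a_i]`, for a tuple that need not lie in `dert`. -/
def tangentialDer (a : Fin n → Ass k n) : Module.End k (Ass k n) :=
  derivation fun i => ad (X i) (a i)

theorem RaisesDegree.tangentialDer {r : ℕ} {a : Fin n → Ass k n}
    (ha : ∀ i, a i ∈ filtration k n r) : RaisesDegree r (tangentialDer a) :=
  RaisesDegree.derivation fun i => RaisesDegree.ad (X_mem_filtration i) r _ (ha i)

theorem ad_X_mem_filtration (i : Fin n) (a : Ass k n) : ad (X i) a ∈ filtration k n 1 :=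
  RaisesDegree.ad (X_mem_filtration i) 0 _ (mem_filtration_zero a)

theorem isDer_tangentialDer (a : Fin n → Ass k n) : IsDer (tangentialDer a) :=
  isDer_derivation fun i => ad_X_mem_filtration i (a i)

theorem tangentialDer_X (a : Fin n → Ass k n) (i : Fin n) :
    tangentialDer a (X i) = ad (X i) (a i) :=
  derivation_X (fun i => ad_X_mem_filtration i (a i)) i

theorem tangentialDer_neg (a : Fin n → Ass k n) : tangentialDer (-a) = -tangentialDer a := by
  rw [← zero_sub (tangentialDer a)]
  refine (isDer_tangentialDer _).ext_X (isDer_zero.sub (isDer_tangentialDer a)) fun i => ?_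
  rw [LinearMap.sub_apply, LinearMap.zero_apply, tangentialDer_X, tangentialDer_X, Pi.neg_apply,
    map_neg, zero_sub]

theorem tangentialDer_mem_lie {a : Fin n → Ass k n} (ha : ∀ i, a i ∈ lie k n) {f : Ass k n}
    (hf : f ∈ lie k n) : tangentialDer a f ∈ lie k n :=
  (isDer_tangentialDer a).map_mem_lie
    (fun i => by rw [tangentialDer_X]; exact ad_mem_lie (X_mem_lie i) (ha i)) hf

theorem mem_dert {a : Fin n → Ass k n} : a ∈ dert k n ↔ ∀ i, a i ∈ lie k n ∧ a i [i] = 0 := by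
  simp [dert]

theorem dert_mem_filtration (u : dert k n) (i : Fin n) : u.1 i ∈ filtration k n 1 :=
  mem_filtration_one_of_mem_lie (mem_dert.1 u.2 i).1

theorem RaisesDegree.tangential (u : dert k n) : RaisesDegree 1 (tangential u) :=
  RaisesDegree.tangentialDer (dert_mem_filtration u)

theorem isDer_tangential (u : dert k n) : IsDer (tangential u) := isDer_tangentialDer u.1

theorem tangential_X (u : dert k n) (i : Fin n) : tangential u (X i) = ad (X i) (u.1 i) :=
  tangentialDer_X u.1 i

theorem tangential_neg (u : dert k n) : tangential (-u) = -tangential u := tangentialDer_neg u.1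

theorem tangential_injective : Function.Injective (tangential (k := k) (n := n)) := by
  intro u v h
  ext i : 2
  have hu := mem_dert.1 u.2 i
  have hv := mem_dert.1 v.2 i
  refine sub_eq_zero.1 (eq_zero_of_ad_X_eq_zero (i := i) (sub_mem hu.1 hv.1) ?_ ?_)
  · rw [Ass.sub_apply, hu.2, hv.2, sub_zero]
  · rw [map_sub, ← tangential_X, ← tangential_X, h, sub_self]

/-- The tuple of the commutator of two tangential derivations. -/
def tangentialBracket (a b : Fin n → Ass k n) (i : Fin n) : Ass k n :=
  ad (a i) (b i) + tangentialDer a (b i) - tangentialDer b (a i)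

theorem tangentialDer_bracket (a b : Fin n → Ass k n) :
    tangentialDer (tangentialBracket a b) = adEnd (tangentialDer a) (tangentialDer b) := by
  have ha := isDer_tangentialDer a
  have hb := isDer_tangentialDer b
  rw [adEnd_apply]
  refine (isDer_tangentialDer _).ext_X (ha.commutator hb) fun i => ?_
  simp only [LinearMap.sub_apply, Module.End.mul_apply, tangentialDer_X, tangentialBracket,
    ha.map_ad, hb.map_ad]
  simp only [ad_apply, map_sub, map_add]
  noncomm_ring

theorem tangentialDer_euler (a : Fin n → Ass k n) :
    tangentialDer (fun i => euler (a i)) = -adEnd (tangentialDer a) euler := by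
  have ha := isDer_tangentialDer a
  rw [adEnd_apply, neg_sub]
  refine (isDer_tangentialDer _).ext_X (isDer_euler.commutator ha) fun i => ?_
  simp only [LinearMap.sub_apply, Module.End.mul_apply, tangentialDer_X, euler_X,
    isDer_euler.map_ad, add_sub_cancel_left]

/-! ### The derivation `κ(F)` -/

/-- The tuple of `-(ad W)^(d+1) l`, where `W` is the tangential derivation of `w`. These are the
terms in the expansion of `κ(exp W) = l - e^(ad W) l`. -/
def kappaTerm (w : Fin n → Ass k n) (d : ℕ) : Fin n → Ass k n :=
  (tangentialBracket w)^[d] fun i => euler (w i)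

theorem kappaTerm_succ (w : Fin n → Ass k n) (d : ℕ) :
    kappaTerm w (d + 1) = tangentialBracket w (kappaTerm w d) :=
  Function.iterate_succ_apply' _ _ _

theorem tangentialDer_kappaTerm (w : Fin n → Ass k n) (d : ℕ) :
    tangentialDer (kappaTerm w d) = -(adEnd (tangentialDer w) ^ (d + 1)) euler := by
  induction d with
  | zero => exact (tangentialDer_euler w).trans (by rw [zero_add, pow_one])
  | succ d ih =>
    rw [kappaTerm_succ, tangentialDer_bracket, ih, pow_succ' _ (d + 1), Module.End.mul_apply,
      map_neg]

theorem kappaTerm_mem_filtration {w : Fin n → Ass k n} (hw : ∀ i, w i ∈ filtration k n 1) (d : ℕ)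
    (i : Fin n) : kappaTerm w d i ∈ filtration k n (d + 1) := by
  induction d generalizing i with
  | zero => exact isDer_euler.continuous _ _ (hw i)
  | succ d ih =>
    rw [kappaTerm_succ]
    refine sub_mem (add_mem (RaisesDegree.ad (hw i) _ _ (ih i))
      (RaisesDegree.tangentialDer hw _ _ (ih i))) ?_
    rw [add_comm (d + 1)]
    exact RaisesDegree.tangentialDer ih _ _ (hw i)

theorem kappaTerm_mem_lie {w : Fin n → Ass k n} (hw : ∀ i, w i ∈ lie k n) (d : ℕ) (i : Fin n) :
    kappaTerm w d i ∈ lie k n := by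
  induction d generalizing i with
  | zero => exact isDer_euler.map_mem_lie (fun i => by rw [euler_X]; exact X_mem_lie i) (hw i)
  | succ d ih =>
    rw [kappaTerm_succ]
    exact sub_mem (add_mem (ad_mem_lie (hw i) (ih i)) (tangentialDer_mem_lie hw (ih i)))
      (tangentialDer_mem_lie ih (hw i))

theorem kappaTerm_linear_coeff {w : Fin n → Ass k n} (hw : ∀ i, w i ∈ filtration k n 1)
    (h : ∀ i, w i [i] = 0) (d : ℕ) (i : Fin n) : kappaTerm w d i [i] = 0 := by
  cases d with
  | zero => exact (euler_apply (w i) [i]).trans (by rw [h, mul_zero])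
  | succ d => exact kappaTerm_mem_filtration hw (d + 1) i [i] (by simp)

/-- The tuple of the tangential derivation `κ(exp W)`, where `W` is the tangential derivation
of `w`. -/
def kappaTuple (w : Fin n → Ass k n) (i : Fin n) : Ass k n :=
  seriesSum fun d => ((d + 1).factorial : k)⁻¹ • kappaTerm w d i

theorem smul_kappaTerm_mem_filtration {w : Fin n → Ass k n} (hw : ∀ i, w i ∈ filtration k n 1)
    (c : ℕ → k) (i : Fin n) (d : ℕ) : c d • kappaTerm w d i ∈ filtration k n d :=
  Submodule.smul_mem _ _ (filtration_anti d.le_succ (kappaTerm_mem_filtration hw d i))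

theorem kappaTuple_mem_dert (u : dert k n) : kappaTuple u.1 ∈ dert k n := by
  refine mem_dert.2 fun i => ⟨seriesSum_mem_lie fun d => Submodule.smul_mem _ _
    (kappaTerm_mem_lie (fun i => (mem_dert.1 u.2 i).1) d i), ?_⟩
  rw [kappaTuple, seriesSum_apply]
  refine Finset.sum_eq_zero fun d _ => ?_
  rw [Ass.smul_apply, kappaTerm_linear_coeff (dert_mem_filtration u)
    (fun i => (mem_dert.1 u.2 i).2), mul_zero]

theorem RaisesDegree.adEnd_pow {W E : Module.End k (Ass k n)} (hW : RaisesDegree 1 W)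
    (hE : RaisesDegree 0 E) (d : ℕ) : RaisesDegree d ((adEnd W ^ d) E) := by
  induction d with
  | zero => exact hE
  | succ d ih =>
    rw [pow_succ', Module.End.mul_apply, adEnd_apply]
    exact (hW.mul ih).sub (by rw [add_comm]; exact ih.mul hW)

theorem expEnd_conj_eq_add [CharZero k] {W E : Module.End k (Ass k n)} (hW : RaisesDegree 1 W)
    (hE : RaisesDegree 0 E) (f : Ass k n) : expEnd W (E (expEnd (-W) f)) =
      E f + seriesSum fun d => ((d + 1).factorial : k)⁻¹ • (adEnd W ^ (d + 1)) E f := by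
  have hterm (d : ℕ) : (d.factorial : k)⁻¹ • (adEnd W ^ d) E f ∈ filtration k n d :=
    Submodule.smul_mem _ _ (by simpa using hW.adEnd_pow hE d 0 f (mem_filtration_zero f))
  rw [expEnd_conj hW hE, seriesSum_succ hterm]
  simp

theorem IsDer.conj {D : Module.End k (Ass k n)} (hD : IsDer D) {φ ψ : Ass k n →ₐ[k] Ass k n}
    (hφ : RaisesDegree 0 φ.toLinearMap) (hψ : RaisesDegree 0 ψ.toLinearMap)
    (hφψ : ∀ f, φ (ψ f) = f) : IsDer (φ.toLinearMap * D * ψ.toLinearMap) where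
  continuous := (hφ.mul hD.continuous).mul hψ
  leibniz f g := by
    simp only [Module.End.mul_apply, AlgHom.toLinearMap_apply, map_mul, hD.leibniz, map_add, hφψ]

theorem IsDer.expEnd_conj [CharZero k] {D W : Module.End k (Ass k n)} (hD : IsDer D)
    (hW : IsDer W) (hW1 : RaisesDegree 1 W) : IsDer (expEnd W * D * expEnd (-W)) :=
  have hW' : IsDer (-W) := zero_sub W ▸ isDer_zero.sub hW
  hD.conj (φ := hW.expAlgHom hW1) (ψ := hW'.expAlgHom hW1.neg) hW1.expEnd hW1.neg.expEnd
    (expEnd_expEnd_neg hW1)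

theorem tangentialDer_kappaTuple [CharZero k] {w : Fin n → Ass k n}
    (hw : ∀ i, w i ∈ filtration k n 1) : tangentialDer (kappaTuple w) =
      euler - expEnd (tangentialDer w) * euler * expEnd (-tangentialDer w) := by
  have hW : RaisesDegree 1 (tangentialDer w) := RaisesDegree.tangentialDer hw
  refine (isDer_tangentialDer _).ext_X
    (isDer_euler.sub (isDer_euler.expEnd_conj (isDer_tangentialDer w) hW)) fun i => ?_
  rw [LinearMap.sub_apply, Module.End.mul_apply, Module.End.mul_apply,
    expEnd_conj_eq_add hW isDer_euler.continuous, sub_add_cancel_left, ← map_neg, tangentialDer_X,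
    kappaTuple, map_seriesSum (RaisesDegree.ad (mem_filtration_zero (X i)))
      (smul_kappaTerm_mem_filtration hw _ i)]
  congr 1
  ext1 d
  rw [Pi.neg_apply, map_smul, ← tangentialDer_X, tangentialDer_kappaTerm, LinearMap.neg_apply,
    smul_neg]

theorem Dert.act_inv (F : Dert k n) : F⁻¹.act = expEnd (-tangential F.log) :=
  congrArg expEnd (tangential_neg F.log)

/-- The normalised tuple of `κ(F)`. -/
def kappaDert (F : Dert k n) : dert k n := ⟨kappaTuple F.log.1, kappaTuple_mem_dert F.log⟩

theorem tangential_kappaDert [CharZero k] (F : Dert k n) : tangential (kappaDert F) = kappa F := by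
  rw [kappa, F.act_inv]
  exact tangentialDer_kappaTuple (dert_mem_filtration F.log)

theorem existsUnique_tangential_eq_kappa [CharZero k] (F : Dert k n) :
    ∃! u : dert k n, tangential u = kappa F :=
  ⟨kappaDert F, tangential_kappaDert F, fun _ hu =>
    tangential_injective (hu.trans (tangential_kappaDert F).symm)⟩

/-! ### Removing the last letter -/

theorem partialDer_apply (i : Fin n) (f : Ass k n) (w : List (Fin n)) :
    partialDer i f w = f (w ++ [i]) := rfl

theorem partialDer_mul_X (i j : Fin n) (f : Ass k n) :
    partialDer i (f * X j) = if i = j then f else 0 := by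
  ext w
  rw [partialDer_apply, mul_X_append]
  split_ifs <;> rfl

theorem sum_partialDer_mul_X_apply (f : Ass k n) {w : List (Fin n)} (hw : w ≠ []) :
    (∑ i, partialDer i f * X i : Ass k n) w = f w := by
  obtain ⟨v, j, rfl⟩ := List.eq_nil_or_concat' w |>.resolve_left hw
  simp [mul_X_append, partialDer_apply]

theorem sum_X_mul_partialDer_apply (f : Ass k n) {w : List (Fin n)} (hw : w ≠ []) :
    (∑ i, X i * partialDer i f : Ass k n) w = f (w.rotate 1) := by
  obtain ⟨j, v, rfl⟩ := List.exists_cons_of_ne_nil hw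
  simp [X_mul_cons, partialDer_apply]

theorem sum_partialDer_mul_X {f : Ass k n} (hf : f ∈ filtration k n 1) :
    ∑ i, partialDer i f * X i = f := by
  ext w
  by_cases hw : w = []
  · simp [hw, mul_X_nil, mem_filtration_one.1 hf]
  · exact sum_partialDer_mul_X_apply f hw

theorem partialDer_mul (i : Fin n) (f : Ass k n) {g : Ass k n} (hg : g ∈ filtration k n 1) :
    partialDer i (f * g) = f * partialDer i g := by
  conv_lhs => rw [← sum_partialDer_mul_X hg, Finset.mul_sum, map_sum]
  simp [← mul_assoc, partialDer_mul_X]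

theorem RaisesDegree.mulLeft_X_comp_partialDer (i : Fin n) :
    RaisesDegree 0 (LinearMap.mulLeft k (X i) ∘ₗ partialDer i) := fun N f hf w hw => by
  rw [LinearMap.comp_apply, LinearMap.mulLeft_apply]
  cases w with
  | nil => exact X_mul_nil _ _
  | cons j v =>
    rw [X_mul_cons]
    split_ifs
    · exact hf (v ++ [i]) (by simpa using hw)
    · rfl

/-! ### Cyclic words -/

/-- The sum of the coefficients of a series over the rotations of a word. Its kernel consists of
the constants and the closure of the commutators, so that it computes in `tr`. -/
def cyclicSum : Module.End k (Ass k n) where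
  toFun f := Ass.of fun w => ∑ i ∈ Finset.range w.length, f (w.rotate i)
  map_add' f g := by ext w; simp [Finset.sum_add_distrib]
  map_smul' c f := by ext w; simp [Finset.mul_sum]

theorem cyclicSum_apply (f : Ass k n) (w : List (Fin n)) :
    cyclicSum f w = ∑ i ∈ Finset.range w.length, f (w.rotate i) := rfl

theorem RaisesDegree.cyclicSum : RaisesDegree 0 (cyclicSum : Module.End k (Ass k n)) :=
  fun _ f hf w hw => by
    rw [cyclicSum_apply]
    exact Finset.sum_eq_zero fun _ _ => hf _ (by rwa [List.length_rotate])

theorem sum_range_rotate {α M : Type*} [AddCommMonoid M] (φ : List α → M) (w : List α) (j : ℕ) :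
    ∑ i ∈ Finset.range w.length, φ (w.rotate (i + j)) =
      ∑ i ∈ Finset.range w.length, φ (w.rotate i) := by
  induction j with
  | zero => rfl
  | succ j ih =>
    rw [← ih]
    cases hw : w.length with
    | zero => rfl
    | succ L =>
      rw [Finset.sum_range_succ, Finset.sum_range_succ' (fun i => φ (w.rotate (i + j))),
        show L + (j + 1) = w.length + j by omega, ← List.rotate_rotate, List.rotate_length,
        zero_add]
      simp only [add_right_comm _ 1 j, add_assoc]

theorem cyclicSum_mul_comm (f g : Ass k n) : cyclicSum (f * g) = cyclicSum (g * f) := by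
  ext w
  have cyclicSum_mul_apply (a b : Ass k n) : cyclicSum (a * b) w =
      ∑ j ∈ Finset.range (w.length + 1), ∑ i ∈ Finset.range w.length,
        a ((w.rotate i).take j) * b ((w.rotate i).drop j) := by
    rw [cyclicSum_apply, Finset.sum_comm]
    exact Finset.sum_congr rfl fun i _ => by rw [Ass.mul_apply, List.length_rotate]
  rw [cyclicSum_mul_apply, cyclicSum_mul_apply, ← Finset.sum_range_reflect]
  refine Finset.sum_congr rfl fun j hj => ?_
  rw [Finset.mem_range] at hj
  rw [← sum_range_rotate (fun v => g (v.take j) * f (v.drop j)) w (w.length - j)]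
  refine Finset.sum_congr rfl fun i _ => ?_
  have hrotate : w.rotate (i + (w.length - j)) =
      (w.rotate i).drop (w.length - j) ++ (w.rotate i).take (w.length - j) := by
    rw [← List.rotate_rotate, List.rotate_eq_drop_append_take]
    rw [List.length_rotate]
    omega
  have hlength : ((w.rotate i).drop (w.length - j)).length = j := by
    rw [List.length_drop, List.length_rotate]
    omega
  rw [show w.length + 1 - 1 - j = w.length - j by omega, hrotate, List.take_left' hlength,
    List.drop_left' hlength, mul_comm]

theorem cyclicSum_ad (f g : Ass k n) : cyclicSum (ad f g) = 0 := by
  rw [ad_apply, map_sub, cyclicSum_mul_comm, sub_self]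

theorem cyclicSum_one : cyclicSum (1 : Ass k n) = 0 := by
  ext w
  cases w with
  | nil => rfl
  | cons i w => simp [cyclicSum_apply, Ass.one_apply]

theorem cyclicSum_euler_apply (f : Ass k n) (w : List (Fin n)) :
    cyclicSum (euler f) w = (w.length : k) * cyclicSum f w := by
  simp only [cyclicSum_apply, euler_apply, List.length_rotate, Finset.mul_sum]

/-- On a cyclic group of order `N`, a function with sum `0` is a difference `g - (g ∘ shift)`:
one takes `g = -(1/N) ∑ j (f ∘ shift^j)`. -/
theorem exists_sub_rotate_eq [CharZero k] {f : Ass k n} (hf : cyclicSum f = 0) :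
    ∃ g : Ass k n, ∀ w ≠ [], g w - g (w.rotate 1) = f w := by
  refine ⟨Ass.of fun w =>
    -((w.length : k)⁻¹ * ∑ j ∈ Finset.range w.length, (j : k) * f (w.rotate j)), fun w hw => ?_⟩
  have hlength : (w.length : k) ≠ 0 := Nat.cast_ne_zero.2 (mt List.length_eq_zero_iff.1 hw)
  have hzero : ∑ j ∈ Finset.range w.length, f (w.rotate (j + 1)) = 0 := by
    rw [sum_range_rotate f w 1, ← cyclicSum_apply, hf, Ass.zero_apply]
  have hshift : ∑ j ∈ Finset.range w.length, (j : k) * f (w.rotate (j + 1)) =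
      ∑ j ∈ Finset.range w.length, (j : k) * f (w.rotate j) + w.length * f w := by
    have h := Finset.sum_range_succ (fun j => (j : k) * f (w.rotate j)) w.length
    rw [Finset.sum_range_succ'] at h
    simpa [add_mul, Finset.sum_add_distrib, hzero] using h
  have hrotate (j : ℕ) : (w.rotate 1).rotate j = w.rotate (j + 1) := by
    rw [List.rotate_rotate, add_comm]
  simp only [Ass.of_apply, List.length_rotate, hrotate, hshift]
  field_simp
  ring

theorem exists_eq_smul_one_add_sum_ad_X [CharZero k] {f : Ass k n} (hf : cyclicSum f = 0) :
    ∃ b : Fin n → Ass k n, f = f [] • (1 : Ass k n) + ∑ i, ad (X i) (b i) := by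
  obtain ⟨g, hg⟩ := exists_sub_rotate_eq hf
  refine ⟨fun i => -partialDer i g, ?_⟩
  ext w
  simp only [map_neg, ad_apply, neg_sub, Finset.sum_sub_distrib, Ass.add_apply, Ass.sub_apply,
    Ass.smul_apply, Ass.one_apply]
  by_cases hw : w = []
  · simp [hw, X_mul_nil, mul_X_nil]
  · rw [sum_partialDer_mul_X_apply g hw, sum_X_mul_partialDer_apply g hw, hg w hw, if_neg hw,
      mul_zero, zero_add]

theorem Tr_eq_Tr_iff [CharZero k] {f g : Ass k n} : Tr f = Tr g ↔ cyclicSum f = cyclicSum g := by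
  rw [← sub_eq_zero, ← map_sub, ← sub_eq_zero (a := cyclicSum f), ← map_sub]
  generalize f - g = h
  rw [Tr, LinearMap.comp_apply, Submodule.mkQ_apply, Submodule.Quotient.mk_eq_zero, commutators,
    Submodule.mem_comap]
  change h - h [] • (1 : Ass k n) ∈ _ ↔ _
  constructor
  · intro hmem
    have hle : Submodule.span k {c : Ass k n | ∃ a b, c = a * b - b * a} ≤
        LinearMap.ker cyclicSum := by
      rw [Submodule.span_le]
      rintro _ ⟨a, b, rfl⟩
      exact cyclicSum_ad a b
    simpa [cyclicSum_one] using hle hmem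
  · intro hcyc
    obtain ⟨b, hb⟩ := exists_eq_smul_one_add_sum_ad_X hcyc
    rw [sub_eq_of_eq_add' hb]
    exact sum_mem fun i _ => Submodule.subset_span ⟨X i, b i, rfl⟩

theorem IsDer.cyclicSum_eq_zero [CharZero k] {D : Module.End k (Ass k n)} (hD : IsDer D)
    {f : Ass k n} (hf : cyclicSum f = 0) : cyclicSum (D f) = 0 := by
  obtain ⟨b, hb⟩ := exists_eq_smul_one_add_sum_ad_X hf
  rw [hb, map_add, map_smul, hD.map_one, smul_zero, zero_add, map_sum, map_sum]
  refine Finset.sum_eq_zero fun i _ => ?_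
  rw [hD.map_ad, map_add, cyclicSum_ad, cyclicSum_ad, add_zero]

/-! ### The divergence cocycle -/

/-- The representative `∑ x_i ∂_i a_i` of the divergence, for a tuple that need not lie in
`dert`. -/
def divSeries : (Fin n → Ass k n) →ₗ[k] Ass k n :=
  ∑ i, (LinearMap.mulLeft k (X i) ∘ₗ partialDer i) ∘ₗ LinearMap.proj i

theorem divSeries_apply (a : Fin n → Ass k n) : divSeries a = ∑ i, X i * partialDer i (a i) := by
  simp [divSeries]

theorem divSeries_mem_filtration {r : ℕ} {a : Fin n → Ass k n}
    (ha : ∀ i, a i ∈ filtration k n r) : divSeries a ∈ filtration k n r := by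
  rw [divSeries_apply]
  exact sum_mem fun i _ => RaisesDegree.mulLeft_X_comp_partialDer i _ _ (ha i)

theorem divSeries_seriesSum {c : ℕ → Fin n → Ass k n}
    (hc : ∀ i d, c d i ∈ filtration k n d) :
    divSeries (fun i => seriesSum fun d => c d i) = seriesSum fun d => divSeries (c d) := by
  simp only [divSeries_apply]
  rw [show (fun d => ∑ i, X i * partialDer i (c d i)) =
    ∑ i, fun d => X i * partialDer i (c d i) by ext1 d; simp, map_sum]
  exact Finset.sum_congr rfl fun i _ =>
    map_seriesSum (RaisesDegree.mulLeft_X_comp_partialDer i) (hc i)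

theorem divSeries_euler (a : Fin n → Ass k n) :
    divSeries (fun i => euler (a i)) = euler (divSeries a) := by
  simp only [divSeries_apply, map_sum]
  refine Finset.sum_congr rfl fun i _ => ?_
  ext w
  rw [euler_apply]
  cases w with
  | nil => simp [X_mul_nil]
  | cons j v =>
    rw [X_mul_cons, X_mul_cons]
    split_ifs
    · simp [partialDer_apply, euler_apply]
    · rw [mul_zero]

theorem partialDer_tangentialDer {a : Fin n → Ass k n} (ha : ∀ i, a i ∈ filtration k n 1)
    {b : Ass k n} (hb : b ∈ filtration k n 1) (i : Fin n) :
    partialDer i (tangentialDer a b) = tangentialDer a (partialDer i b) - partialDer i b * a i +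
      ∑ j, partialDer j b * (X j * partialDer i (a j)) := by
  have hterm (j : Fin n) : partialDer i (tangentialDer a (partialDer j b * X j)) =
      (if i = j then tangentialDer a (partialDer j b) - partialDer j b * a j else 0) +
        partialDer j b * (X j * partialDer i (a j)) := by
    rw [(isDer_tangentialDer a).leibniz, tangentialDer_X, ad_apply, mul_sub, ← mul_assoc _ (a j),
      map_add, map_sub, partialDer_mul_X, partialDer_mul_X, ← mul_assoc, partialDer_mul i _ (ha j),
      mul_assoc]
    split_ifs <;> abel
  conv_lhs => rw [← sum_partialDer_mul_X hb, map_sum, map_sum]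
  simp [hterm, Finset.sum_add_distrib]

/-- The trace `∑ x_i (∂_j b_i) x_j (∂_i a_j)` of the product of the Jacobi matrices of two
tangential derivations: the part of the divergence of `D_a b` that is symmetric in `tr`. -/
def jacobianTrace (a b : Fin n → Ass k n) : Ass k n :=
  ∑ i, ∑ j, X i * partialDer j (b i) * (X j * partialDer i (a j))

theorem cyclicSum_jacobianTrace_comm (a b : Fin n → Ass k n) :
    cyclicSum (jacobianTrace a b) = cyclicSum (jacobianTrace b a) := by
  rw [jacobianTrace, Finset.sum_comm]
  simp only [jacobianTrace, map_sum]
  exact Finset.sum_congr rfl fun i _ => Finset.sum_congr rfl fun j _ => cyclicSum_mul_comm _ _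

theorem divSeries_tangentialDer {a b : Fin n → Ass k n} (ha : ∀ i, a i ∈ filtration k n 1)
    (hb : ∀ i, b i ∈ filtration k n 1) :
    divSeries (fun i => tangentialDer a (b i)) = tangentialDer a (divSeries b) +
      ∑ i, ad (a i) (X i * partialDer i (b i)) - divSeries (a * b) + jacobianTrace a b := by
  simp only [divSeries_apply, jacobianTrace, map_sum]
  rw [← Finset.sum_add_distrib, ← Finset.sum_sub_distrib, ← Finset.sum_add_distrib]
  refine Finset.sum_congr rfl fun i _ => ?_
  rw [partialDer_tangentialDer ha (hb i), (isDer_tangentialDer a).leibniz, tangentialDer_X,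
    Pi.mul_apply, partialDer_mul i _ (hb i)]
  simp only [mul_add, mul_sub, Finset.mul_sum, ad_apply, sub_mul, mul_assoc]
  abel

theorem cyclicSum_divSeries_bracket {a b : Fin n → Ass k n} (ha : ∀ i, a i ∈ filtration k n 1)
    (hb : ∀ i, b i ∈ filtration k n 1) : cyclicSum (divSeries (tangentialBracket a b)) =
      cyclicSum (tangentialDer a (divSeries b)) - cyclicSum (tangentialDer b (divSeries a)) := by
  have hbracket : tangentialBracket a b = a * b - b * a + (fun i => tangentialDer a (b i)) -
      fun i => tangentialDer b (a i) := rfl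
  simp only [hbracket, map_sub, map_add, divSeries_tangentialDer ha hb,
    divSeries_tangentialDer hb ha, map_sum, cyclicSum_ad, Finset.sum_const_zero,
    cyclicSum_jacobianTrace_comm b a]
  abel

/-! ### The divergence of `κ(F)` -/

/-- The operator `f ↦ D f + f(0) b`. On `k ⊕ Ass⁺` it encodes the affine action
`f ↦ D f + b` of `D` on `Ass⁺`, so that operators twisted by a cocycle can be exponentiated. -/
def affineEnd (D : Module.End k (Ass k n)) (b : Ass k n) : Module.End k (Ass k n) :=
  D + (coeff []).smulRight b

section affineEnd

variable {D E : Module.End k (Ass k n)} {b c : Ass k n}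

theorem affineEnd_apply (D : Module.End k (Ass k n)) (b f : Ass k n) :
    affineEnd D b f = D f + f [] • b := rfl

theorem affineEnd_zero (D : Module.End k (Ass k n)) : affineEnd D 0 = D := by
  ext1 f
  rw [affineEnd_apply, smul_zero, add_zero]

theorem affineEnd_one (hD : D 1 = 0) : affineEnd D b 1 = b := by
  rw [affineEnd_apply, hD, Ass.one_apply, if_pos rfl, one_smul, zero_add]

theorem affineEnd_apply_of_mem {f : Ass k n} (hf : f ∈ filtration k n 1) :
    affineEnd D b f = D f := by
  rw [affineEnd_apply, mem_filtration_one.1 hf, zero_smul, add_zero]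

theorem RaisesDegree.affineEnd (hD : RaisesDegree 1 D) (hb : b ∈ filtration k n 1) :
    RaisesDegree 1 (affineEnd D b) := by
  intro N f hf
  refine add_mem (hD N f hf) ?_
  cases N with
  | zero => exact Submodule.smul_mem _ _ hb
  | succ N =>
    rw [LinearMap.smulRight_apply, coeff_apply, hf [] N.succ_pos, zero_smul]
    exact zero_mem _

theorem adEnd_affineEnd (hD : ∀ f, D f ∈ filtration k n 1) (hE : ∀ f, E f ∈ filtration k n 1)
    (hb : b ∈ filtration k n 1) (hc : c ∈ filtration k n 1) :
    adEnd (affineEnd D b) (affineEnd E c) = affineEnd (adEnd D E) (D c - E b) := by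
  ext1 f
  have hDf : affineEnd D b f ∈ filtration k n 1 := add_mem (hD f) (Submodule.smul_mem _ _ hb)
  have hEf : affineEnd E c f ∈ filtration k n 1 := add_mem (hE f) (Submodule.smul_mem _ _ hc)
  simp only [adEnd_apply, LinearMap.sub_apply, Module.End.mul_apply, affineEnd_apply_of_mem hDf,
    affineEnd_apply_of_mem hEf]
  simp only [affineEnd_apply, map_add, map_smul, LinearMap.sub_apply, Module.End.mul_apply,
    smul_sub]
  abel

theorem affineEnd_pow_apply_of_mem (hD : RaisesDegree 1 D) {f : Ass k n}
    (hf : f ∈ filtration k n 1) (d : ℕ) : (affineEnd D b ^ d) f = (D ^ d) f := by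
  induction d with
  | zero => rfl
  | succ d ih =>
    rw [pow_succ', Module.End.mul_apply, ih,
      affineEnd_apply_of_mem ((hD.pow d).continuous 1 f hf), pow_succ', Module.End.mul_apply]

theorem expEnd_affineEnd_apply_of_mem (hD : RaisesDegree 1 D) {f : Ass k n}
    (hf : f ∈ filtration k n 1) : expEnd (affineEnd D b) f = expEnd D f := by
  simp only [expEnd_apply, affineEnd_pow_apply_of_mem hD hf]

theorem expEnd_affineEnd_one (hD : RaisesDegree 1 D) (hD1 : D 1 = 0)
    (hb : b ∈ filtration k n 1) : expEnd (affineEnd D b) 1 = 1 + expSubOneDiv D b := by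
  rw [expEnd_apply, seriesSum_succ ((hD.affineEnd hb).smul_pow_apply_mem _ 1), expSubOneDiv_apply]
  simp [pow_succ, affineEnd_one hD1, affineEnd_pow_apply_of_mem hD hb]

/-- `e^(-D̂)` undoes `e^D̂ 1 = 1 + ((e^D - 1)/D) b`, where `D̂` is the affine operator. -/
theorem expEnd_neg_affineEnd_one [CharZero k] (hD : RaisesDegree 1 D) (hD1 : D 1 = 0)
    (hb : b ∈ filtration k n 1) :
    expEnd (-affineEnd D b) 1 = 1 - expEnd (-D) (expSubOneDiv D b) := by
  have hneg : -affineEnd D b = affineEnd (-D) (-b) := by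
    ext1 f
    simp only [LinearMap.neg_apply, affineEnd_apply, smul_neg, neg_add]
  have h := expEnd_neg_expEnd (hD.affineEnd hb) 1
  rw [expEnd_affineEnd_one hD hD1 hb, map_add, hneg,
    expEnd_affineEnd_apply_of_mem hD.neg (hD.expSubOneDiv 1 b hb)] at h
  rw [hneg, ← sub_eq_iff_eq_add.2 h.symm]

end affineEnd

theorem cyclicSum_map_congr {T : Module.End k (Ass k n)}
    (hT : ∀ f, cyclicSum f = 0 → cyclicSum (T f) = 0) {f g : Ass k n}
    (h : cyclicSum f = cyclicSum g) : cyclicSum (T f) = cyclicSum (T g) := by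
  rw [← sub_eq_zero, ← map_sub] at h ⊢
  rw [← map_sub]
  exact hT _ h

theorem exists_adEnd_affineEnd_pow_euler [CharZero k] {w : Fin n → Ass k n}
    (hw : ∀ i, w i ∈ filtration k n 1) (d : ℕ) : ∃ c ∈ filtration k n 1,
      (adEnd (affineEnd (tangentialDer w) (divSeries w)) ^ (d + 1)) euler =
        affineEnd ((adEnd (tangentialDer w) ^ (d + 1)) euler) c ∧
      cyclicSum c = -cyclicSum (divSeries (kappaTerm w d)) := by
  have hW := (isDer_tangentialDer w).map_mem_filtration_one
  have hdiv := divSeries_mem_filtration hw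
  induction d with
  | zero =>
    refine ⟨-euler (divSeries w), neg_mem (isDer_euler.continuous _ _ hdiv), ?_, ?_⟩
    · have h := adEnd_affineEnd hW isDer_euler.map_mem_filtration_one hdiv (zero_mem _)
      rw [affineEnd_zero, map_zero, zero_sub] at h
      simpa only [zero_add, pow_one] using h
    · rw [map_neg, kappaTerm, Function.iterate_zero_apply, divSeries_euler]
  | succ d ih =>
    obtain ⟨c, hc, hpow, hcyc⟩ := ih
    have hK := tangentialDer_kappaTerm w d
    rw [← neg_eq_iff_eq_neg] at hK
    have hE (f : Ass k n) : (adEnd (tangentialDer w) ^ (d + 1)) euler f ∈ filtration k n 1 := by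
      rw [← hK]
      exact neg_mem ((isDer_tangentialDer _).map_mem_filtration_one f)
    refine ⟨_, sub_mem (hW c) (hE (divSeries w)), ?_, ?_⟩
    · rw [pow_succ' _ (d + 1), Module.End.mul_apply, hpow, adEnd_affineEnd hW hE hdiv hc,
        pow_succ' (adEnd (tangentialDer w)) (d + 1), Module.End.mul_apply]
    · rw [← map_neg] at hcyc
      rw [map_sub, cyclicSum_map_congr (fun _ => (isDer_tangentialDer w).cyclicSum_eq_zero) hcyc,
        ← hK, kappaTerm_succ, cyclicSum_divSeries_bracket hw
          fun i => filtration_anti (Nat.le_add_left 1 d) (kappaTerm_mem_filtration hw d i)]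
      simp only [map_neg, LinearMap.neg_apply]
      abel

theorem cyclicSum_adEnd_affineEnd_pow_euler_one [CharZero k] {w : Fin n → Ass k n}
    (hw : ∀ i, w i ∈ filtration k n 1) (d : ℕ) :
    cyclicSum ((adEnd (affineEnd (tangentialDer w) (divSeries w)) ^ (d + 1)) euler 1) =
      -cyclicSum (divSeries (kappaTerm w d)) := by
  obtain ⟨c, -, hpow, hcyc⟩ := exists_adEnd_affineEnd_pow_euler hw d
  rw [hpow, affineEnd_one, hcyc]
  rw [← neg_eq_zero, ← LinearMap.neg_apply, ← tangentialDer_kappaTerm,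
    (isDer_tangentialDer _).map_one]

/-- Both sides are read off from `e^Ŵ l e^(-Ŵ) 1`, where `Ŵ` is the derivation `W` of `w`, twisted
by its divergence: expanding in powers of `ad Ŵ` gives the divergence of `κ(exp W)` term by term. -/
theorem cyclicSum_divSeries_kappaTuple [CharZero k] {w : Fin n → Ass k n}
    (hw : ∀ i, w i ∈ filtration k n 1) : cyclicSum (divSeries (kappaTuple w)) =
      cyclicSum (expEnd (tangentialDer w) (euler (expEnd (-tangentialDer w)
        (expSubOneDiv (tangentialDer w) (divSeries w))))) := by
  have hW := RaisesDegree.tangentialDer hw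
  have hdiv := divSeries_mem_filtration hw
  set Ŵ := affineEnd (tangentialDer w) (divSeries w)
  have hŴ : RaisesDegree 1 Ŵ := hW.affineEnd hdiv
  have hexpand := expEnd_conj_eq_add hŴ isDer_euler.continuous 1
  rw [expEnd_affineEnd_apply_of_mem hW (isDer_euler.map_mem_filtration_one _),
    expEnd_neg_affineEnd_one hW (isDer_tangentialDer w).map_one hdiv, map_sub,
    isDer_euler.map_one, zero_sub, zero_add, map_neg] at hexpand
  have hterm (d : ℕ) : ((d + 1).factorial : k)⁻¹ • (adEnd Ŵ ^ (d + 1)) euler 1 ∈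
      filtration k n d := by
    have h := hŴ.adEnd_pow isDer_euler.continuous (d + 1) 0 1 (mem_filtration_zero 1)
    exact Submodule.smul_mem _ _ (filtration_anti (by omega) h)
  have hcoeff (d : ℕ) : divSeries (fun i => ((d + 1).factorial : k)⁻¹ • kappaTerm w d i) ∈
      filtration k n d :=
    divSeries_mem_filtration fun i =>
      smul_kappaTerm_mem_filtration hw (fun d => ((d + 1).factorial : k)⁻¹) i d
  have hkappa : divSeries (kappaTuple w) = seriesSum fun d => divSeries _ :=
    divSeries_seriesSum (smul_kappaTerm_mem_filtration hw _)
  rw [← neg_inj, ← map_neg cyclicSum (expEnd _ _), hexpand,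
    map_seriesSum RaisesDegree.cyclicSum hterm, hkappa,
    map_seriesSum RaisesDegree.cyclicSum hcoeff, ← map_neg]
  congr 1
  ext1 d
  rw [map_smul, cyclicSum_adEnd_affineEnd_pow_euler_one hw, smul_neg, ← map_smul, ← map_smul]
  rfl

/-! ### Automorphisms and the Euler derivation on `tr` -/

theorem IsDer.Tr_map_congr [CharZero k] {D : Module.End k (Ass k n)} (hD : IsDer D)
    {f g : Ass k n} (h : Tr f = Tr g) : Tr (D f) = Tr (D g) :=
  Tr_eq_Tr_iff.2 (cyclicSum_map_congr (fun _ => hD.cyclicSum_eq_zero) (Tr_eq_Tr_iff.1 h))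

theorem Tr_ad [CharZero k] (f g : Ass k n) : Tr (ad f g) = 0 := by
  rw [← map_zero Tr, Tr_eq_Tr_iff, cyclicSum_ad, map_zero]

theorem coe_dropConst (f : Ass k n) : (dropConst f : Ass k n) = f - f [] • (1 : Ass k n) := rfl

theorem Tr_one : Tr (1 : Ass k n) = 0 := by
  have h : dropConst (1 : Ass k n) = 0 := Subtype.ext (by simp [coe_dropConst, Ass.one_apply])
  rw [Tr, LinearMap.comp_apply, h, map_zero]

theorem Tr_algHom_congr [CharZero k] (φ : Ass k m →ₐ[k] Ass k n) {f g : Ass k m}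
    (h : Tr f = Tr g) : Tr (φ f) = Tr (φ g) := by
  rw [← sub_eq_zero, ← map_sub, ← map_sub]
  obtain ⟨b, hb⟩ := exists_eq_smul_one_add_sum_ad_X (f := f - g)
    (by rw [map_sub, Tr_eq_Tr_iff.1 h, sub_self])
  have hφ (i : Fin m) : φ (ad (X i) (b i)) = ad (φ (X i)) (φ (b i)) := by
    simp only [ad_apply, map_sub, map_mul]
  rw [hb]
  simp only [map_add, map_smul, map_one, map_sum, hφ, Tr_ad, Tr_one, smul_zero,
    Finset.sum_const_zero, add_zero]

theorem Tr_euler_inj [CharZero k] {f g : Ass k n} :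
    Tr (euler f) = Tr (euler g) ↔ Tr f = Tr g := by
  refine ⟨fun h => Tr_eq_Tr_iff.2 ?_, isDer_euler.Tr_map_congr⟩
  rw [Tr_eq_Tr_iff] at h
  ext w
  have hw := congrArg (coeff w) h
  rw [coeff_apply, coeff_apply, cyclicSum_euler_apply, cyclicSum_euler_apply, mul_eq_mul_left_iff,
    Nat.cast_eq_zero, List.length_eq_zero_iff] at hw
  exact hw.elim id (by rintro rfl; rfl)

theorem Tr_comp_euler_surjective [CharZero k] :
    Function.Surjective fun f : Ass k n => Tr (euler f) := by
  intro t
  obtain ⟨⟨f, hf⟩, rfl⟩ := (commutators k n).mkQ_surjective t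
  refine ⟨Ass.of fun w => (w.length : k)⁻¹ * f w, congrArg _ (Subtype.ext (Ass.ext fun w => ?_))⟩
  have hf' : f [] = 0 := hf
  by_cases hw : w = []
  · simp [coe_dropConst, hw, hf', euler_apply]
  · simp [coe_dropConst, euler_apply, hw]

namespace Dert

variable (F : Dert k n)

theorem act_act_inv [CharZero k] (f : Ass k n) : F.act (F⁻¹.act f) = f := by
  rw [act_inv]
  exact expEnd_expEnd_neg (RaisesDegree.tangential F.log) f

theorem act_inv_act [CharZero k] (f : Ass k n) : F⁻¹.act (F.act f) = f := by
  rw [act_inv]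
  exact expEnd_neg_expEnd (RaisesDegree.tangential F.log) f

theorem Tr_act_inj [CharZero k] {f g : Ass k n} : Tr (F.act f) = Tr (F.act g) ↔ Tr f = Tr g := by
  have congr (G : Dert k n) {f g : Ass k n} (h : Tr f = Tr g) : Tr (G.act f) = Tr (G.act g) :=
    Tr_algHom_congr ((isDer_tangential G.log).expAlgHom (RaisesDegree.tangential G.log)) h
  exact ⟨fun h => by simpa only [act_inv_act] using congr F⁻¹ h, congr F⟩

theorem Tr_conj_euler_inj [CharZero k] {f g : Ass k n} :
    Tr (F.act (euler (F⁻¹.act f))) = Tr (F.act (euler (F⁻¹.act g))) ↔ Tr f = Tr g := by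
  rw [Tr_act_inj, Tr_euler_inj, Tr_act_inj]

end Dert

/-! ### Solutions of the generalized Kashiwara-Vergne problem -/

theorem eq_zero_of_euler_eq_self [CharZero k] {f : Ass k n} (hf : f ∈ filtration k n 2)
    (h : euler f = f) : f = 0 := by
  ext w
  by_cases hw : w.length < 2
  · exact hf w hw
  · have hw' := congrArg (coeff w) h
    rw [coeff_apply, coeff_apply, euler_apply] at hw'
    by_contra hne
    have hone : w.length = 1 := by exact_mod_cast (mul_eq_right₀ hne).1 hw'
    omega

/-- The series `f(y) - f(z) + f(x)`, which represents `deltaTilde` when `z = ch(x, y)`. -/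
def deltaSeries (z : Ass k 2) : Ass k 1 →ₗ[k] Ass k 2 :=
  subst (fun _ => X 1) - subst (fun _ => z) + subst (fun _ => X 0)

theorem deltaSeries_apply (z : Ass k 2) (f : Ass k 1) : deltaSeries z f =
    subst (fun _ => X 1) f - subst (fun _ => z) f + subst (fun _ => X 0) f := rfl

theorem deltaSeries_one {z : Ass k 2} (hz : z ∈ filtration k 2 1) : deltaSeries z 1 = 1 := by
  have h {a : Ass k 2} (ha : a ∈ filtration k 2 1) : subst (fun _ : Fin 1 => a) 1 = 1 :=
    subst_monomial (fun _ => ha) []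
  rw [deltaSeries_apply, h (X_mem_filtration 1), h hz, h (X_mem_filtration 0), sub_add_cancel]

theorem deltaTilde_Tr (f : Ass k 1) :
    deltaTilde k (Tr f) = Tr (deltaSeries (ch (X 0) (X 1)) f) := by
  change Tr (deltaSeries _ (f - f [] • (1 : Ass k 1))) = _
  rw [map_sub, map_sub, map_smul, map_smul,
    deltaSeries_one (ch_mem_filtration (X_mem_filtration 0) (X_mem_filtration 1)), Tr_one,
    smul_zero, sub_zero]

theorem IsDer.Tr_map_deltaSeries [CharZero k] {D : Module.End k (Ass k 2)} (hD : IsDer D)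
    {a : Fin 2 → Ass k 2} (hX : ∀ i, D (X i) = X i + ad (X i) (a i)) {z : Ass k 2}
    (hz : z ∈ filtration k 2 1) (hDz : D z = z) (f : Ass k 1) :
    Tr (D (deltaSeries z f)) = Tr (deltaSeries z (euler f)) := by
  have hDz' : D z = z + ad z 0 := by rw [hDz, map_zero, add_zero]
  simp only [deltaSeries_apply, map_add, map_sub, Tr_ad, add_zero,
    hD.map_subst_eq_euler_add (X_mem_filtration _) (hX _), hD.map_subst_eq_euler_add hz hDz']

/-- As `x + y` is the linear part of `ch(x, y)`, it is the only eigenvector of `l` with eigenvalue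
`1` that `F` can send to `ch(x, y)`. -/
theorem act_add_eq_ch_iff [CharZero k] (F : Dert k 2) : F.act (X 0 + X 1) = ch (X 0) (X 1) ↔
    F.act (euler (F⁻¹.act (ch (X 0) (X 1)))) = ch (X 0) (X 1) := by
  have hx : X 0 ∈ filtration k 2 1 := X_mem_filtration 0
  have hy : X 1 ∈ filtration k 2 1 := X_mem_filtration 1
  constructor
  · intro h
    rw [← h, F.act_inv_act, map_add, euler_X, euler_X]
  · intro h
    set c : Ass k 2 := ch (X 0) (X 1)
    have hfix : euler (F⁻¹.act c) = F⁻¹.act c := by rw [← F.act_inv_act (euler _), h]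
    have hact : F⁻¹.act c - c ∈ filtration k 2 2 :=
      (RaisesDegree.tangential F⁻¹.log).expEnd_sub_one 1 c (ch_mem_filtration hx hy)
    have hlinear : F⁻¹.act c - (X 0 + X 1) ∈ filtration k 2 2 := by
      rw [← sub_add_sub_cancel _ c]
      exact add_mem hact (ch_sub_add_mem_filtration hx hy)
    have hzero := eq_zero_of_euler_eq_self hlinear
      (by rw [map_sub, hfix, map_add, euler_X, euler_X])
    rw [← sub_eq_zero.1 hzero, F.act_act_inv]

theorem act_euler_act_inv {F : Dert k n} {u : dert k n} (hu : tangential u = kappa F)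
    (f : Ass k n) : F.act (euler (F⁻¹.act f)) = euler f - tangential u f := by
  rw [hu, kappa, LinearMap.sub_apply, sub_sub_cancel]
  rfl

theorem act_add_eq_ch_iff_originalKVEquation [CharZero k] {F : Dert k 2} {u : dert k 2}
    (hu : tangential u = kappa F) :
    F.act (X 0 + X 1) = ch (X 0) (X 1) ↔ OriginalKVEquation (u.1 0) (u.1 1) := by
  have hX (i : Fin 2) :
      (tangential u - euler : Module.End k (Ass k 2)) (X i) = ad (X i) (u.1 i) - X i := by
    rw [LinearMap.sub_apply, tangential_X, euler_X]
  rw [act_add_eq_ch_iff, act_euler_act_inv hu, OriginalKVEquation,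
    ← ((isDer_tangential u).sub isDer_euler).map_ch_eq_neg_iff (X_mem_filtration 0)
      (X_mem_filtration 1) (hX 0) (hX 1), LinearMap.sub_apply, ← neg_inj, neg_sub]

theorem Tr_conj_euler_deltaSeries [CharZero k] {F : Dert k 2} {u : dert k 2}
    (hF : F.act (X 0 + X 1) = ch (X 0) (X 1)) (hu : tangential u = kappa F) (f : Ass k 1) :
    Tr (F.act (euler (F⁻¹.act (deltaSeries (ch (X 0) (X 1)) f)))) =
      Tr (deltaSeries (ch (X 0) (X 1)) (euler f)) := by
  rw [act_euler_act_inv hu, ← LinearMap.sub_apply]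
  refine (isDer_euler.sub (isDer_tangential u)).Tr_map_deltaSeries (a := -u.1) (fun i => ?_)
    (ch_mem_filtration (X_mem_filtration 0) (X_mem_filtration 1)) ?_ f
  · rw [LinearMap.sub_apply, euler_X, tangential_X, Pi.neg_apply, map_neg, sub_eq_add_neg]
  · rw [LinearMap.sub_apply, ← act_euler_act_inv hu, (act_add_eq_ch_iff F).1 hF]

theorem div_eq_Tr_conj_euler [CharZero k] {F : Dert k n} {u : dert k n}
    (hu : tangential u = kappa F) : div u =
      Tr (F.act (euler (F⁻¹.act (expSubOneDiv (tangential F.log) (divRep F.log))))) := by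
  rw [tangential_injective (hu.trans (tangential_kappaDert F).symm), F.act_inv, div, divRep,
    divRep, ← divSeries_apply, ← divSeries_apply, Tr_eq_Tr_iff]
  exact cyclicSum_divSeries_kappaTuple (dert_mem_filtration F.log)

theorem j_mem_range_iff [CharZero k] {F : Dert k 2} {u : dert k 2}
    (hF : F.act (X 0 + X 1) = ch (X 0) (X 1)) (hu : tangential u = kappa F) :
    j F ∈ LinearMap.range (deltaTilde k) ↔ div u ∈ LinearMap.range (deltaTilde k) := by
  have hTr : Function.Surjective (Tr : Ass k 1 → tr k 1) := fun t =>
    (Tr_comp_euler_surjective t).imp' euler fun _ h => h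
  rw [div_eq_Tr_conj_euler hu, j, LinearMap.mem_range, LinearMap.mem_range, hTr.exists,
    Tr_comp_euler_surjective.exists]
  refine exists_congr fun f => ?_
  rw [deltaTilde_Tr, deltaTilde_Tr, ← Tr_conj_euler_deltaSeries hF hu, F.Tr_conj_euler_inj]

end

end KV

theorem mainTheorem5 (k : Type*) [Field k] [CharZero k] (F : KV.Dert k 2) :
    (∃! u : KV.dert k 2, KV.tangential u = KV.kappa F) ∧
    ∀ u : KV.dert k 2, KV.tangential u = KV.kappa F →
      (KV.IsGeneralizedKVSolution F ↔
        KV.OriginalKVEquation (u.1 0) (u.1 1) ∧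
          KV.div u ∈ LinearMap.range (KV.deltaTilde k)) := by
  refine ⟨KV.existsUnique_tangential_eq_kappa F, fun u hu => ?_⟩
  rw [KV.IsGeneralizedKVSolution, ← KV.act_add_eq_ch_iff_originalKVEquation hu]
  exact and_congr_right fun hF => KV.j_mem_range_iff hF hu
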